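/- Let $R$ be a Noetherian domain and let $$F^\bullet:\ 0\to F^{-k}\to\cdots\to F^{i}\xrightarrow{\partial^{i}}F^{i+1}\to\cdots\to F^{\ell}\to 0\qquad(k,\ell\ge 0)$$ be a complex of finitely generated free $R$-modules (put $F^i=0$ for $i\notin[-k,\ell]$). Let $\mathrm{Hom}_R(F^\bullet,R)$ be the dual complex, with $\mathrm{Hom}_R(F^i,R)$ placed in degree $-i$, and assume that $H^i(F^\bullet)=0$ and $H^i(\mathrm{Hom}_R(F^\bullet,R))=0$ for all $i<0$. For a map $\phi$ of finitely generated free modules let $I_r(\phi)$ be the ideal generated by the minors of size $r$ of a matrix of $\phi$ (with $I_0(\phi)=R$, and $I_r(\phi)=0$ when $r$ exceeds the size of the matrix). For $i\in\mathbb Z$ define the Fitting ideal $I^i=I_{\mathrm{rank}\,\partial^i}(\partial^i)$, the jumping ideal $J^i=I_{\mathrm{rank}\,F^i}(\partial^{i-1}\oplus\partial^i)$, where $\partial^{i-1}\oplus\partial^i: F^{i-1}\oplus F^i\to F^i\oplus F^{i+1}$, and the jump locus $\mathcal V^i=V(J^i)\subseteq\mathrm{Spec}\,R$, where $\mathrm{Spec}\,R$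 is the prime spectrum. The depth of an ideal is the maximal length of a regular sequence in $R$ contained in it, and the depth of the unit ideal is $\infty$. Then: (0) $\sqrt{I^i}=\sqrt{J^i}$ for every $i<0$, and $\sqrt{I^{i-1}}=\sqrt{J^i}$ for every $i>0$. (i) $\mathcal V^{-k}\subseteq\cdots\subseteq\mathcal V^{-1}\subseteq\mathcal V^{0}\supseteq\mathcal V^{1}\supseteq\cdots\supseteq\mathcal V^{\ell}$. (ii) $\operatorname{depth}J^{i}\ge i$ and $\operatorname{depth}J^{-i}\ge i$ for every $i\ge 0$. (iii) Let $V$ be an irreducible component of $\mathcal V^0$, let $\mathfrak p$ be the corresponding prime ideal (so $V=V(\mathfrak p)$), and let $d$ be the depth of the maximal ideal of the local ring $R_{\mathfrak p}$. Then there are integers $a_1\le 0\le a_2$ with $a_2-a_1\ge d$ such that, for $i\in\mathbb Z$, $V$ is an irreducible component of $\mathcal V^i$ if and only if $a_1\le i\le a_2$. Moreover (i) also holds for the jump loci in the maximal spectrum of $R$ (the sets of maximal ideals containing $J^i$), and so does (iii) if $R$ is a Jacobson ring, with $V$ then the set of maximal ideals containing $\mathfrak p$. -/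

import Mathlib

universe u

open CategoryTheory

noncomputable section

/-- The ideal generated by the minors of size `k` of a matrix. (Choices of rows or columns with
repetitions contribute the determinant `0`, and reorderings only change signs; the only minor of
size `0` is `1`, and there are no nonzero minors of size larger than that of the matrix.) -/
def Matrix.minorsIdeal {R : Type*} [CommRing R] {m n : Type*} (k : ℕ) (A : Matrix m n R) :
    Ideal R :=
  Ideal.span {a | ∃ (f : Fin k → m) (g : Fin k → n), a = (A.submatrix f g).det}

open Classical in
/-- The `k`-th determinantal ideal `I_k(φ)` of a linear map between finitely generated free
modules: the ideal of minors of size `k` of a matrix of `φ`. It does not depend on the bases, see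
`determinantalIdeal_eq`. -/
def determinantalIdeal {R : Type*} [CommRing R] {M N : Type*} [AddCommGroup M] [Module R M]
    [AddCommGroup N] [Module R N] [Module.Free R M] [Module.Finite R M]
    [Module.Free R N] [Module.Finite R N] (k : ℕ) (φ : M →ₗ[R] N) : Ideal R :=
  (LinearMap.toMatrix (Module.Free.chooseBasis R M) (Module.Free.chooseBasis R N) φ).minorsIdeal k

theorem Matrix.det_mul_mem_of_submatrix_rows {R : Type*} [CommRing R] {n : Type*} [Fintype n]
    {k : ℕ} (I : Ideal R) (F : Matrix (Fin k) n R) (B : Matrix n (Fin k) R)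
    (h : ∀ r : Fin k → n, (B.submatrix r id).det ∈ I) : (F * B).det ∈ I := by
  classical
  have e : F * B = Matrix.of fun i => ∑ p, F i p • B p := by
    ext i j
    simp [Matrix.mul_apply, Finset.sum_apply]
  have e2 : (F * B).det
      = ∑ r : Fin k → n, (Matrix.detRowAlternating (R := R) (n := Fin k)).toMultilinearMap
          (fun i => F i (r i) • B (r i)) := by
    rw [e]
    exact MultilinearMap.map_sum
      (Matrix.detRowAlternating (R := R) (n := Fin k)).toMultilinearMap
      (fun i p => F i p • B p)
  rw [e2]
  refine Ideal.sum_mem _ fun r _ => ?_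
  rw [MultilinearMap.map_smul_univ]
  exact Ideal.mul_mem_left _ _ (h r)

theorem Matrix.minorsIdeal_toMatrix_eq {R : Type*} [CommRing R] {M N : Type*} [AddCommGroup M]
    [Module R M] [AddCommGroup N] [Module R N] {m n : Type*} [Fintype m] [DecidableEq m]
    [Fintype n] (b : Module.Basis m R M) (c : Module.Basis n R N)
    (k : ℕ) (φ : M →ₗ[R] N) :
    (LinearMap.toMatrix b c φ).minorsIdeal k =
      Ideal.span {a | ∃ (f : Fin k → Module.Dual R N) (x : Fin k → M),
        a = (Matrix.of fun i j => f i (φ (x j))).det} := by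
  classical
  apply le_antisymm
  · refine Ideal.span_mono ?_
    rintro a ⟨f, g, rfl⟩
    refine ⟨fun i => c.coord (f i), fun j => b (g j), ?_⟩
    congr 1
    ext i j
    simp [LinearMap.toMatrix_apply]
  · refine Ideal.span_le.mpr ?_
    rintro a ⟨f, x, rfl⟩
    have e : (Matrix.of fun i j => f i (φ (x j))) =
        (Matrix.of fun i p => f i (c p)) *
          (LinearMap.toMatrix b c φ * Matrix.of fun q j => b.repr (x j) q) := by
      ext i j
      have h1 : φ (x j) = ∑ p, c.repr (φ (x j)) p • c p := (c.sum_repr _).symm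
      have h2 : ∀ p, c.repr (φ (x j)) p
          = (LinearMap.toMatrix b c φ * Matrix.of fun q j => b.repr (x j) q) p j := by
        intro p
        have := congrFun (LinearMap.toMatrix_mulVec_repr b c φ (x j)) p
        rw [← this]
        rfl
      rw [Matrix.of_apply, h1, map_sum, Matrix.mul_apply]
      refine Finset.sum_congr rfl fun p _ => ?_
      rw [map_smul, smul_eq_mul, h2, mul_comm]
      rfl
    rw [e]
    refine Matrix.det_mul_mem_of_submatrix_rows _ _ _ fun r => ?_
    have e3 : ((LinearMap.toMatrix b c φ * Matrix.of fun q j => b.repr (x j) q).submatrix r id)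
        = (LinearMap.toMatrix b c φ).submatrix r id * Matrix.of fun q j => b.repr (x j) q := by
      ext i j
      simp [Matrix.mul_apply]
    rw [e3, ← Matrix.det_transpose, Matrix.transpose_mul]
    refine Matrix.det_mul_mem_of_submatrix_rows _ _ _ fun s => ?_
    refine Ideal.subset_span ⟨r, s, ?_⟩
    rw [← Matrix.det_transpose]
    rfl

/-- The determinantal ideals may be computed with any bases. -/
theorem determinantalIdeal_eq {R : Type*} [CommRing R] {M N : Type*} [AddCommGroup M] [Module R M]
    [AddCommGroup N] [Module R N] [Module.Free R M] [Module.Finite R M]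
    [Module.Free R N] [Module.Finite R N] {m n : Type*} [Fintype m] [DecidableEq m] [Fintype n]
    (b : Module.Basis m R M) (c : Module.Basis n R N) (k : ℕ) (φ : M →ₗ[R] N) :
    determinantalIdeal k φ = (LinearMap.toMatrix b c φ).minorsIdeal k := by
  classical
  rw [determinantalIdeal, Matrix.minorsIdeal_toMatrix_eq, Matrix.minorsIdeal_toMatrix_eq]

/-- The depth (grade) of an ideal `I`: the supremum of the lengths of the regular sequences
contained in `I`, with the convention that the unit ideal has depth `∞`. (If `I` is proper, then
a weakly regular sequence with terms in `I` is regular; if `I` is the unit ideal, then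
`1, 1, …, 1` is weakly regular.) -/
def Ideal.gradeDepth {R : Type*} [CommRing R] (I : Ideal R) : ℕ∞ :=
  ⨆ (rs : List R) (_ : (∀ r ∈ rs, r ∈ I) ∧ RingTheory.Sequence.IsWeaklyRegular R rs),
    (rs.length : ℕ∞)

/-- `V` is an irreducible component of the subset `S` of a topological space: a maximal
irreducible subset of `S`. -/
def IsIrreducibleComponentOf {X : Type*} [TopologicalSpace X] (V S : Set X) : Prop :=
  Maximal (fun T : Set X => IsIrreducible T ∧ T ⊆ S) V

namespace CochainComplex

variable {R : Type u} [CommRing R]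

/-- The dual complex `Hom_R(F, R)`, with `Hom_R(F^i, R)` placed in degree `-i` and with the
transposes of the differentials of `F` as differentials. -/
def dualComplex (F : CochainComplex (ModuleCat.{u} R) ℤ) : CochainComplex (ModuleCat.{u} R) ℤ where
  X i := ModuleCat.of R (Module.Dual R (F.X (-i)))
  d i j := ModuleCat.ofHom (F.d (-j) (-i)).hom.dualMap
  shape i j h := by
    have : F.d (-j) (-i) = 0 := F.shape _ _ (by
      intro h'
      apply h
      simp only [ComplexShape.up_Rel] at h' ⊢
      omega)
    rw [this]
    ext f
    simp
  d_comp_d' i j k _ _ := by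
    ext f x
    have h : F.d (-k) (-j) ≫ F.d (-j) (-i) = 0 := F.d_comp_d _ _ _
    have h' : (F.d (-j) (-i)).hom ((F.d (-k) (-j)).hom x) = 0 := by
      rw [← LinearMap.comp_apply, ← ModuleCat.hom_comp, h]
      rfl
    simp [h']

variable (F : CochainComplex (ModuleCat.{u} R) ℤ)
  [∀ i, Module.Free R (F.X i)] [∀ i, Module.Finite R (F.X i)]

/-- The degree `i` Fitting ideal `I_{rank ∂^i}(∂^i)`, where `rank ∂^i` is the rank of the image
of `∂^i`. -/
def fittingIdeal (i : ℤ) : Ideal R :=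
  determinantalIdeal (Module.finrank R (LinearMap.range (F.d i (i + 1)).hom)) (F.d i (i + 1)).hom

/-- The degree `i` jumping ideal `I_{rank F^i}(∂^{i-1} ⊕ ∂^i)`, where
`∂^{i-1} ⊕ ∂^i : F^{i-1} ⊕ F^i → F^i ⊕ F^{i+1}`. -/
def jumpingIdeal (i : ℤ) : Ideal R :=
  determinantalIdeal (Module.finrank R (F.X i))
    (LinearMap.prodMap (F.d (i - 1) i).hom (F.d i (i + 1)).hom)

/-- The `i`-th cohomology jump locus in the prime spectrum. -/
def jumpLocus (i : ℤ) : Set (PrimeSpectrum R) :=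
  PrimeSpectrum.zeroLocus (F.jumpingIdeal i : Set R)

/-- The `i`-th cohomology jump locus in the maximal spectrum. -/
def maxJumpLocus (i : ℤ) : Set (MaximalSpectrum R) :=
  {x | F.jumpingIdeal i ≤ x.asIdeal}

end CochainComplex

end

/-! Everything is read off from ranks over residue fields. Since `∂∂ = 0`, `rank ∂^{i-1} + rank ∂^i
≤ rank F^i` over `k(p)`, with equality exactly when `F ⊗ k(p)` is acyclic in degree `i`; hence `J^i
⊆ p` iff acyclicity fails there. Ranks can only drop under specialization, so acyclicity at `p` in
degree `i` forces both adjacent differentials to keep their generic rank at `p`.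

Conversely, a matrix `A` with generic rank at `p` has `H` and `d ∉ p` with `A * H * A = d • A`, so
it splits near `p`. In degrees `i < 0`, exactness then makes acyclicity at `p` equivalent to `∂^i`
keeping its rank, that is, to `I^i ⊄ p`. Acyclicity in degree `i ≤ 0` thus passes to degree `i - 1`;
the dual complex covers positive degrees. This yields the radicals and the propagation.

For depth, reduction modulo a regular sequence of length `g` keeps exactness in degrees below `-g`.
If `p` is associated to the quotient, `R/p` embeds in it, and induction from the bottom gives
acyclicity at `p` below degree `-g` (`IsNegExact.acyclicAt_of_forall_mem_iff`). So no such `p`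
contains `J^{-n}` when `g < n`.

For components, let `[a, b]` be the range of degrees not acyclic at `p`, with `p` minimal over
`J^0`. At smaller primes the whole complex is acyclic, so a nonzero homology module over `R_p` in
the relevant degrees has a socle. A regular sequence moves socle elements down to degree `a - 1`,
where the complex is exact modulo every ideal. If `b - a` were less than the depth, the complex
would be exact through degree `b`, hence acyclic at `p` in degree `b`
(`acyclicAt_of_lt_gradeDepth`), a contradiction. -/

namespace Matrix

/-! ### Ranks, minors and generalized inverses over a field. -/

section Field

variable {K m n : Type*} [Field K]

theorem exists_linearIndependent_rows_of_le_rank [Finite m] [Fintype n] (A : Matrix m n K) {k : ℕ}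
    (hk : k ≤ A.rank) : ∃ f : Fin k → m, LinearIndependent K (A.submatrix f id).row := by
  cases nonempty_fintype m
  rw [A.rank_eq_finrank_span_row] at hk
  obtain ⟨g, hg, -, hli⟩ := Submodule.exists_fun_fin_finrank_span_eq K (Set.range A.row)
  choose r hr using hg
  refine ⟨fun i => r (Fin.castLE hk i), ?_⟩
  have e : (A.submatrix (fun i => r (Fin.castLE hk i)) id).row = g ∘ Fin.castLE hk := by
    ext i j
    exact congrFun (hr (Fin.castLE hk i)) j
  rw [e]
  exact hli.comp (Fin.castLE hk) (Fin.castLE_injective hk)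

theorem exists_submatrix_det_ne_zero_iff [Fintype m] [Fintype n] (A : Matrix m n K) {k : ℕ} :
    (∃ (f : Fin k → m) (g : Fin k → n), (A.submatrix f g).det ≠ 0) ↔ k ≤ A.rank := by
  constructor
  · rintro ⟨f, g, h⟩
    have h1 := rank_of_isUnit (A.submatrix f g)
      ((isUnit_iff_isUnit_det _).mpr (isUnit_iff_ne_zero.mpr h))
    rw [Fintype.card_fin] at h1
    rw [← h1]
    exact rank_submatrix_le _ _ _
  · intro hk
    obtain ⟨f, hf⟩ := A.exists_linearIndependent_rows_of_le_rank hk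
    have h1 : (A.submatrix f id)ᵀ.rank = k := by
      rw [rank_transpose, hf.rank_matrix, Fintype.card_fin]
    obtain ⟨g, hg⟩ := (A.submatrix f id)ᵀ.exists_linearIndependent_rows_of_le_rank h1.ge
    refine ⟨f, g, ?_⟩
    rw [linearIndependent_rows_iff_isUnit, isUnit_iff_isUnit_det, isUnit_iff_ne_zero,
      ← det_transpose] at hg
    exact hg

theorem rank_fromBlocks_diagonal {m' n' : Type*} [Fintype n] [Fintype n'] [Finite m] [Finite m']
    (A : Matrix m n K) (B : Matrix m' n' K) :
    (fromBlocks A 0 0 B).rank = A.rank + B.rank := by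
  cases nonempty_fintype m
  cases nonempty_fintype m'
  have h : (fromBlocks A 0 0 B).mulVecLin =
      ((LinearEquiv.sumArrowLequivProdArrow m m' K K).symm.toLinearMap ∘ₗ
        (A.mulVecLin.prodMap B.mulVecLin)) ∘ₗ
        (LinearEquiv.sumArrowLequivProdArrow n n' K K).toLinearMap := by
    refine LinearMap.ext fun x => ?_
    ext (i | i)
    · simp [fromBlocks_mulVec]
      rfl
    · simp [fromBlocks_mulVec]
      rfl
  rw [rank, h, LinearMap.range_comp_of_range_eq_top _ (LinearEquiv.range _), LinearMap.range_comp,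
    LinearEquiv.finrank_map_eq, LinearMap.range_prodMap, rank, rank, ← Module.finrank_prod]
  rw [← LinearMap.finrank_range_of_inj (f := A.mulVecLin.range.subtype.prodMap
    B.mulVecLin.range.subtype) (Prod.map_injective.mpr
      ⟨Subtype.val_injective, Subtype.val_injective⟩), LinearMap.range_prodMap,
    Submodule.range_subtype, Submodule.range_subtype]

theorem exists_mul_eq_of_rank_le {r : Type*} [Fintype r] [Fintype m] [Fintype n] (A : Matrix m n K)
    (f : r → m) (h : A.rank ≤ (A.submatrix f id).rank) :
    ∃ C : Matrix m r K, C * A.submatrix f id = A := by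
  have hle : Submodule.span K (Set.range (A.submatrix f id).row) ≤
      Submodule.span K (Set.range A.row) := by
    refine Submodule.span_mono ?_
    rintro _ ⟨i, rfl⟩
    exact ⟨f i, rfl⟩
  have heq := Submodule.eq_of_le_of_finrank_le hle (by
    rwa [← rank_eq_finrank_span_row, ← rank_eq_finrank_span_row])
  have hmem : ∀ i, ∃ c : r → K, ∑ j, c j • (A.submatrix f id).row j = A.row i := by
    intro i
    have : A.row i ∈ Submodule.span K (Set.range (A.submatrix f id).row) := by
      rw [heq]
      exact Submodule.subset_span ⟨i, rfl⟩
    exact (Submodule.mem_span_range_iff_exists_fun K).mp this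
  choose C hC using hmem
  refine ⟨of C, ?_⟩
  ext i j
  have := congrFun (hC i) j
  simpa [mul_apply, Finset.sum_apply] using this

/-- The chosen rows span the row space, so `A = C * A.submatrix f id`. The adjugate replaces the
inverse of the minor, which keeps the formula free of denominators and lets it descend to a domain.
-/
theorem exists_mul_mul_eq_smul {r : Type*} [Fintype r] [DecidableEq r] [Fintype m] [Fintype n]
    [DecidableEq m] [DecidableEq n]
    (A : Matrix m n K) (f : r → m) (g : r → n) (hA : A.rank = Fintype.card r)
    (h : (A.submatrix f g).det ≠ 0) :
    A * ((1 : Matrix n n K).submatrix id g * (A.submatrix f g).adjugate *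
      (1 : Matrix m m K).submatrix f id) * A = (A.submatrix f g).det • A := by
  have h1 := rank_of_isUnit (A.submatrix f g)
    ((isUnit_iff_isUnit_det _).mpr (isUnit_iff_ne_zero.mpr h))
  have h2 : A.rank ≤ (A.submatrix f id).rank := by
    rw [hA, ← h1]
    exact rank_submatrix_le (A.submatrix f id) id g
  obtain ⟨C, hC⟩ := A.exists_mul_eq_of_rank_le f h2
  have e1 : A * (1 : Matrix n n K).submatrix id g = C * A.submatrix f g := by
    have : A * (1 : Matrix n n K).submatrix id g = A.submatrix id g := by
      ext i j; simp [mul_apply, one_apply]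
    rw [this]
    conv_lhs => rw [← hC]
    ext i j
    simp [mul_apply]
  have e2 : (1 : Matrix m m K).submatrix f id * A = A.submatrix f id := by
    ext i j; simp [mul_apply, one_apply]
  calc _ = (A * (1 : Matrix n n K).submatrix id g) * (A.submatrix f g).adjugate *
          ((1 : Matrix m m K).submatrix f id * A) := by simp only [Matrix.mul_assoc]
    _ = C * (A.submatrix f g * (A.submatrix f g).adjugate) * A.submatrix f id := by
          rw [e1, e2]; simp only [Matrix.mul_assoc]
    _ = _ := by
          rw [mul_adjugate, Matrix.mul_smul, Matrix.mul_one, Matrix.smul_mul, hC]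

theorem rank_add_rank_eq_card_iff {l : Type*} [Fintype l] [Fintype m] [Fintype n]
    {A : Matrix m l K} {B : Matrix n m K} (h : B * A = 0) :
    A.rank + B.rank = Fintype.card m ↔ ∀ x, B *ᵥ x = 0 → ∃ y, A *ᵥ y = x := by
  have hle : LinearMap.range A.mulVecLin ≤ LinearMap.ker B.mulVecLin := by
    rintro _ ⟨y, rfl⟩
    simp [h]
  have hrk : B.rank + Module.finrank K (LinearMap.ker B.mulVecLin) = Fintype.card m := by
    rw [rank, LinearMap.finrank_range_add_finrank_ker, Module.finrank_fintype_fun_eq_card]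
  constructor
  · intro he x hx
    have := Submodule.eq_of_le_of_finrank_le hle (by unfold rank at *; omega)
    have hx' : x ∈ LinearMap.ker B.mulVecLin := hx
    rw [← this] at hx'
    exact hx'
  · intro he
    have : LinearMap.range A.mulVecLin = LinearMap.ker B.mulVecLin :=
      le_antisymm hle fun x hx => he x hx
    rw [← this] at hrk
    unfold rank at *
    omega

end Field

end Matrix

/-! ### Ranks at a prime ideal. -/

namespace Matrix

section RankAt

variable {R : Type*} [CommRing R] {l m n : Type*}

/-- The rank of a matrix at a prime ideal, that is, over the residue field. -/
noncomputable def rankAt [Fintype n] (p : Ideal R) [p.IsPrime] (A : Matrix m n R) : ℕ :=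
  (A.map (algebraMap R p.ResidueField)).rank

theorem exists_minor_notMem_iff [Fintype m] [Fintype n] (p : Ideal R) [p.IsPrime]
    (A : Matrix m n R) {k : ℕ} :
    (∃ (f : Fin k → m) (g : Fin k → n), (A.submatrix f g).det ∉ p) ↔ k ≤ A.rankAt p := by
  rw [rankAt, ← exists_submatrix_det_ne_zero_iff]
  refine exists₂_congr fun f g => not_congr ?_
  rw [← Ideal.algebraMap_residueField_eq_zero (I := p), RingHom.map_det, submatrix_map]
  rfl

theorem minorsIdeal_le_iff [Fintype m] [Fintype n] (p : Ideal R) [p.IsPrime]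
    (A : Matrix m n R) {k : ℕ} : A.minorsIdeal k ≤ p ↔ A.rankAt p < k := by
  rw [← not_le, ← exists_minor_notMem_iff, minorsIdeal, Ideal.span_le]
  push Not
  constructor
  · intro h f g
    exact h ⟨f, g, rfl⟩
  · rintro h _ ⟨f, g, rfl⟩
    exact h f g

theorem rankAt_le_rankAt [Fintype m] [Fintype n] {q p : Ideal R} [q.IsPrime] [p.IsPrime]
    (h : q ≤ p) (A : Matrix m n R) : A.rankAt p ≤ A.rankAt q := by
  obtain ⟨f, g, hfg⟩ := (exists_minor_notMem_iff p A).mpr le_rfl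
  exact (exists_minor_notMem_iff q A).mp ⟨f, g, fun h' => hfg (h h')⟩

theorem rankAt_transpose [Fintype m] [Fintype n] (p : Ideal R) [p.IsPrime] (A : Matrix m n R) :
    Aᵀ.rankAt p = A.rankAt p := by
  rw [rankAt, rankAt, transpose_map, rank_transpose]

theorem rankAt_fromBlocks_diagonal {m' n' : Type*} [Fintype n] [Fintype n'] [Finite m] [Finite m']
    (p : Ideal R) [p.IsPrime] (A : Matrix m n R) (B : Matrix m' n' R) :
    (fromBlocks A 0 0 B).rankAt p = A.rankAt p + B.rankAt p := by
  rw [rankAt, fromBlocks_map, Matrix.map_zero _ (map_zero _), Matrix.map_zero _ (map_zero _),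
    rank_fromBlocks_diagonal, rankAt, rankAt]

theorem rankAt_le_card_height [Fintype m] [Fintype n] (p : Ideal R) [p.IsPrime]
    (A : Matrix m n R) : A.rankAt p ≤ Fintype.card m :=
  rank_le_card_height _

theorem rankAt_le_card_width [Fintype n] (p : Ideal R) [p.IsPrime]
    (A : Matrix m n R) : A.rankAt p ≤ Fintype.card n :=
  rank_le_card_width _

theorem map_mul_map_eq_zero [Fintype m] {S : Type*} [CommRing S] (f : R →+* S)
    {A : Matrix m l R} {B : Matrix n m R} (h : B * A = 0) : B.map f * A.map f = 0 := by
  rw [← Matrix.map_mul, h, Matrix.map_zero _ (map_zero f)]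

theorem rankAt_add_rankAt_le [Fintype l] [Fintype m] [Fintype n] (p : Ideal R) [p.IsPrime]
    {A : Matrix m l R} {B : Matrix n m R} (h : B * A = 0) :
    A.rankAt p + B.rankAt p ≤ Fintype.card m := by
  rw [add_comm]
  exact rank_add_rank_le_card_of_mul_eq_zero (map_mul_map_eq_zero _ h)

/-- A minor outside `p` of size the rank at `p` has generic rank size as well, so the adjugate
identity holds over the fraction field and is pulled back to `R`. Once `d` is inverted, the image of
`A` is a direct summand. -/
theorem exists_mul_mul_eq_smul_of_rankAt_eq [IsDomain R] [Fintype m] [Fintype n] (p : Ideal R)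
    [p.IsPrime] (A : Matrix m n R) (h : A.rankAt p = A.rankAt ⊥) :
    ∃ (H : Matrix n m R) (d : R), d ∉ p ∧ A * H * A = d • A := by
  classical
  obtain ⟨f, g, hfg⟩ := (exists_minor_notMem_iff p A).mpr le_rfl
  refine ⟨(1 : Matrix n n R).submatrix id g * (A.submatrix f g).adjugate *
      (1 : Matrix m m R).submatrix f id, _, hfg, ?_⟩
  let φ := algebraMap R (⊥ : Ideal R).ResidueField
  -- The residue field of `⊥` is the fraction field of `R`.
  have hφ : Function.Injective φ := IsFractionRing.injective R _
  have key := exists_mul_mul_eq_smul (A.map φ) f g (by rw [Fintype.card_fin, h]; rfl) (by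
    rw [submatrix_map, ← RingHom.mapMatrix_apply, ← RingHom.map_det, Ne,
      map_eq_zero_iff φ hφ]
    exact fun h0 => hfg (h0 ▸ p.zero_mem))
  apply Matrix.map_injective hφ
  beta_reduce
  rw [Matrix.map_mul, Matrix.map_mul, Matrix.map_mul, Matrix.map_mul]
  have e1 : ((1 : Matrix n n R).submatrix id g).map φ = (1 : Matrix n n _).submatrix id g := by
    rw [← submatrix_map, Matrix.map_one _ (map_zero φ) (map_one φ)]
  have e2 : ((1 : Matrix m m R).submatrix f id).map φ = (1 : Matrix m m _).submatrix f id := by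
    rw [← submatrix_map, Matrix.map_one _ (map_zero φ) (map_one φ)]
  have e3 : (A.submatrix f g).adjugate.map φ = ((A.map φ).submatrix f g).adjugate :=
     RingHom.map_adjugate φ (A.submatrix f g)
  rw [e1, e2, e3, key]
  ext i j
  have : φ (A.submatrix f g).det = ((A.map φ).submatrix f g).det := by
    rw [RingHom.map_det]; rfl
  simp [this]

theorem exists_smul_residueField_eq [Finite m] (p : Ideal R) [p.IsPrime]
    (x : m → p.ResidueField) :
    ∃ s ∉ p, ∃ y : m → R, ∀ i, algebraMap R p.ResidueField (y i) =
      algebraMap R p.ResidueField s * x i := by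
  obtain ⟨b, hb⟩ := IsLocalization.exist_integer_multiples_of_finite
    (nonZeroDivisors (R ⧸ p)) x
  obtain ⟨s, hs⟩ := Ideal.Quotient.mk_surjective (b : R ⧸ p)
  refine ⟨s, ?_, ?_⟩
  · intro h
    have := nonZeroDivisors.ne_zero b.2
    rw [← hs] at this
    exact this (Ideal.Quotient.eq_zero_iff_mem.mpr h)
  · choose c hc using hb
    choose y hy using fun i => Ideal.Quotient.mk_surjective (c i)
    refine ⟨y, fun i => ?_⟩
    rw [← Ideal.algebraMap_quotient_residueField_mk, hy, hc, ← hs, Algebra.smul_def,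
      Ideal.algebraMap_quotient_residueField_mk]

/-- Acyclicity over the residue field, with denominators cleared so that it can be checked on
vectors over `R`. -/
theorem rankAt_add_rankAt_eq_card_iff [Fintype l] [Fintype m] [Fintype n] (p : Ideal R) [p.IsPrime]
    {A : Matrix m l R} {B : Matrix n m R} (h : B * A = 0) :
    A.rankAt p + B.rankAt p = Fintype.card m ↔ ∀ x, (∀ i, (B *ᵥ x) i ∈ p) →
      ∃ s ∉ p, ∃ y, ∀ i, (s • x - A *ᵥ y) i ∈ p := by
  rw [rankAt, rankAt, rank_add_rank_eq_card_iff (map_mul_map_eq_zero _ h)]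
  set φ := algebraMap R p.ResidueField
  have hφ : ∀ a, φ a = 0 ↔ a ∈ p := fun a => Ideal.algebraMap_residueField_eq_zero
  constructor
  · intro H x hx
    obtain ⟨y', hy'⟩ := H (φ ∘ x) (by
      ext i
      rw [← RingHom.map_mulVec]
      exact (hφ _).mpr (hx i))
    obtain ⟨s, hs, y, hy⟩ := exists_smul_residueField_eq p y'
    refine ⟨s, hs, y, fun i => ?_⟩
    have e : φ ∘ y = φ s • y' := funext hy
    rw [← hφ, Pi.sub_apply, map_sub, RingHom.map_mulVec, e, mulVec_smul, hy']
    simp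
  · intro H x' hx'
    obtain ⟨s, hs, x, hx⟩ := exists_smul_residueField_eq p x'
    have e : φ ∘ x = φ s • x' := funext hx
    obtain ⟨t, ht, y, hy⟩ := H x (fun i => by
      rw [← hφ, RingHom.map_mulVec, e, mulVec_smul, hx']
      simp)
    have hts : φ t * φ s ≠ 0 := mul_ne_zero (mt (hφ t).mp ht) (mt (hφ s).mp hs)
    refine ⟨(φ t * φ s)⁻¹ • (φ ∘ y), ?_⟩
    rw [mulVec_smul, inv_smul_eq_iff₀ hts, mul_smul, ← e]
    ext i
    have := (hφ _).mpr (hy i)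
    rw [Pi.sub_apply, map_sub, RingHom.map_mulVec, sub_eq_zero] at this
    rw [← this]
    simp

end RankAt

end Matrix

/-! ### Exactness and socles of homology modulo an ideal. -/

/-- The vectors with entries in an ideal. -/
def Ideal.vec {R : Type*} [CommRing R] (I : Ideal R) (m : Type*) : Submodule R (m → R) :=
  Submodule.pi Set.univ fun _ => I

namespace Ideal

variable {R : Type*} [CommRing R] {I : Ideal R} {m n : Type*}

theorem mem_vec {x : m → R} : x ∈ I.vec m ↔ ∀ i, x i ∈ I := by
  simp [vec, Submodule.mem_pi]

theorem mem_bot_vec {x : m → R} : x ∈ (⊥ : Ideal R).vec m ↔ x = 0 := by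
  simp [mem_vec, funext_iff]

theorem mulVec_mem_vec [Fintype m] (A : Matrix n m R) {x : m → R} (hx : x ∈ I.vec m) :
    A.mulVec x ∈ I.vec n :=
  mem_vec.mpr fun _ => I.sum_mem fun j _ => I.mul_mem_left _ (mem_vec.mp hx j)

theorem smul_mem_vec_of_mem {t : R} (ht : t ∈ I) (x : m → R) : t • x ∈ I.vec m :=
  mem_vec.mpr fun _ => I.mul_mem_right _ ht

theorem vec_mono {J : Ideal R} (h : I ≤ J) : I.vec m ≤ J.vec m :=
  fun _ hx => mem_vec.mpr fun i => h (mem_vec.mp hx i)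

theorem exists_of_mem_sup_span_vec {t : R} {x : m → R} (hx : x ∈ (I ⊔ Ideal.span {t}).vec m) :
    ∃ v, x - t • v ∈ I.vec m := by
  have h : ∀ i, ∃ c, x i - t * c ∈ I := by
    intro i
    obtain ⟨a, ha, b, hb, hab⟩ := Submodule.mem_sup.mp (mem_vec.mp hx i)
    obtain ⟨c, rfl⟩ := Ideal.mem_span_singleton'.mp hb
    exact ⟨c, by rw [← hab, mul_comm]; simpa using ha⟩
  choose v hv using h
  exact ⟨v, mem_vec.mpr hv⟩

theorem mem_vec_of_smul_mem {t : R} (ht : ∀ a, t * a ∈ I → a ∈ I) {x : m → R}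
    (hx : t • x ∈ I.vec m) : x ∈ I.vec m :=
  mem_vec.mpr fun i => ht _ (mem_vec.mp hx i)

end Ideal

namespace Matrix

variable {R : Type*} [CommRing R] {k l m n : Type*}

/-- The sequence `A`, `B` is exact modulo the ideal `I`. -/
def ExactMod [Fintype l] [Fintype m] (I : Ideal R) (A : Matrix m l R) (B : Matrix n m R) : Prop :=
  ∀ x, B *ᵥ x ∈ I.vec n → ∃ y, x - A *ᵥ y ∈ I.vec m

/-- Modulo the ideal `I`, the homology of the sequence `A`, `B` has no nonzero element annihilated
by `𝔪`. -/
def SocleExactMod [Fintype l] [Fintype m] (𝔪 I : Ideal R) (A : Matrix m l R)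
    (B : Matrix n m R) : Prop :=
  ∀ z, B *ᵥ z ∈ I.vec n → (∀ t ∈ 𝔪, ∃ y, t • z - A *ᵥ y ∈ I.vec m) → ∃ y, z - A *ᵥ y ∈ I.vec m

theorem exactMod_bot_iff [Fintype l] [Fintype m] {A : Matrix m l R} {B : Matrix n m R} :
    ExactMod ⊥ A B ↔ ∀ x, B *ᵥ x = 0 → ∃ y, A *ᵥ y = x := by
  simp only [ExactMod, Ideal.mem_bot_vec, sub_eq_zero, eq_comm]

theorem ExactMod.socleExactMod [Fintype l] [Fintype m] {𝔪 I : Ideal R} {A : Matrix m l R}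
    {B : Matrix n m R} (h : ExactMod I A B) : SocleExactMod 𝔪 I A B :=
  fun z hz _ => h z hz

/-- In the long exact sequence of multiplication by `t` on `F/IF`, the homology of `F/(I, t)F` sits
between that of `F/IF` in the same degree and in the next one. -/
theorem ExactMod.sup_span [Fintype k] [Fintype l] [Fintype m] {I : Ideal R} {A : Matrix l k R}
    {B : Matrix m l R} {C : Matrix n m R} (hCB : C * B = 0) (hA : ExactMod I A B)
    (hB : ExactMod I B C) {t : R} (ht : ∀ a, t * a ∈ I → a ∈ I) :
    ExactMod (I ⊔ Ideal.span {t}) A B := by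
  intro x hx
  obtain ⟨z, hz⟩ := Ideal.exists_of_mem_sup_span_vec hx
  have h1 : C *ᵥ z ∈ I.vec n := by
    refine Ideal.mem_vec_of_smul_mem ht ?_
    have := Ideal.mulVec_mem_vec C hz
    rw [mulVec_sub, mulVec_mulVec, hCB, zero_mulVec, zero_sub, mulVec_smul] at this
    exact neg_mem_iff.mp this
  obtain ⟨u, hu⟩ := hB z h1
  obtain ⟨y, hy⟩ := hA (x - t • u) (by
    have : B *ᵥ (x - t • u) = (B *ᵥ x - t • z) + t • (z - B *ᵥ u) := by
      rw [mulVec_sub, mulVec_smul, smul_sub]; abel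
    rw [this]
    exact add_mem hz (Submodule.smul_mem _ _ hu))
  refine ⟨y, ?_⟩
  have : x - A *ᵥ y = (x - t • u - A *ᵥ y) + t • u := by abel
  rw [this]
  exact add_mem (Ideal.vec_mono le_sup_left hy) (Ideal.smul_mem_vec_of_mem
    (Ideal.mem_sup_right (Ideal.mem_span_singleton_self t)) _)

/-- The matrix `d⁻¹H` splits `B`, so exactness survives every base change: `d • x - H *ᵥ (B *ᵥ x)`
is a genuine cycle, and the correction term lies in `I`. -/
theorem ExactMod.of_bot [Fintype l] [Fintype m] [Fintype n] {A : Matrix m l R} {B : Matrix n m R}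
    (h : ExactMod ⊥ A B) {H : Matrix m n R} {d : R} (hd : IsUnit d) (hH : B * H * B = d • B)
    (I : Ideal R) : ExactMod I A B := by
  intro x hx
  obtain ⟨y, hy⟩ := exactMod_bot_iff.mp h (d • x - H *ᵥ (B *ᵥ x)) (by
    rw [mulVec_sub, mulVec_smul, mulVec_mulVec, mulVec_mulVec, hH, smul_mulVec, sub_self])
  obtain ⟨c, hc⟩ := hd.exists_left_inv
  refine ⟨c • y, ?_⟩
  have : x - A *ᵥ (c • y) = c • (H *ᵥ (B *ᵥ x)) := by
    rw [mulVec_smul, hy, smul_sub, smul_smul, hc, one_smul, sub_sub_cancel]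
  rw [this]
  exact Submodule.smul_mem _ _ (Ideal.mulVec_mem_vec H hx)

/-- As the homology modulo `I` vanishes one degree lower, the connecting map identifies the homology
of the lower degree modulo `(I, t)` with the `t`-torsion in the upper degree modulo `I`. This
torsion contains the socle because `t ∈ 𝔪`. -/
theorem SocleExactMod.succ [Fintype k] [Fintype l] [Fintype m] {𝔪 I : Ideal R} {A : Matrix l k R}
    {B : Matrix m l R} {C : Matrix n m R} (hBA : B * A = 0) {t : R} (ht𝔪 : t ∈ 𝔪)
    (ht : ∀ a, t * a ∈ I → a ∈ I)
    (hA : ExactMod I A B) (hS : SocleExactMod 𝔪 (I ⊔ Ideal.span {t}) A B) :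
    SocleExactMod 𝔪 I B C := by
  intro z _ hsoc
  have htm : t ∈ I ⊔ Ideal.span {t} := Ideal.mem_sup_right (Ideal.mem_span_singleton_self t)
  obtain ⟨y, hy⟩ := hsoc t ht𝔪
  obtain ⟨w, hw⟩ := hS y (by
    have : B *ᵥ y = t • z - (t • z - B *ᵥ y) := by abel
    rw [this]
    exact sub_mem (Ideal.smul_mem_vec_of_mem htm _) (Ideal.vec_mono le_sup_left hy)) (by
    intro s hs
    obtain ⟨v, hv⟩ := hsoc s hs
    obtain ⟨u, hu⟩ := hA (s • y - t • v) (by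
      have : B *ᵥ (s • y - t • v) = t • (s • z - B *ᵥ v) - s • (t • z - B *ᵥ y) := by
        rw [mulVec_sub, mulVec_smul, mulVec_smul, smul_sub, smul_sub, smul_comm s t]; abel
      rw [this]
      exact sub_mem (Submodule.smul_mem _ _ hv) (Submodule.smul_mem _ _ hy))
    refine ⟨u, ?_⟩
    have : s • y - A *ᵥ u = (s • y - t • v - A *ᵥ u) + t • v := by abel
    rw [this]
    exact add_mem (Ideal.vec_mono le_sup_left hu) (Ideal.smul_mem_vec_of_mem htm _))
  obtain ⟨v, hv⟩ := Ideal.exists_of_mem_sup_span_vec hw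
  refine ⟨v, Ideal.mem_vec_of_smul_mem ht ?_⟩
  have : t • (z - B *ᵥ v) = (t • z - B *ᵥ y) + B *ᵥ (y - A *ᵥ w - t • v) := by
    rw [mulVec_sub, mulVec_sub, mulVec_mulVec, hBA, zero_mulVec, mulVec_smul, smul_sub]; abel
  rw [this]
  exact add_mem hy (Ideal.mulVec_mem_vec B hv)

theorem exists_smul_eq_of_exactMod_bot [Fintype l] [Fintype m] (p : Ideal R) [p.IsPrime]
    {A : Matrix m l R} {B : Matrix n m R} (h : ExactMod ⊥ A B) (x : m → R) (hx : B *ᵥ x = 0) :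
    ∃ s ∉ p, ∃ y, s • x = A *ᵥ y := by
  obtain ⟨y, hy⟩ := exactMod_bot_iff.mp h x hx
  exact ⟨1, ‹p.IsPrime›.one_notMem, y, by rw [hy, one_smul]⟩

section Domain

variable [IsDomain R] [Fintype l] [Fintype m] [Fintype n]

/-- If the homology of `A`, `B` vanishes at `p` and the rank of `B` does not drop at `p`, then the
homology of the sequence over the residue field vanishes. -/
theorem rankAt_add_rankAt_eq_of_right (p : Ideal R) [p.IsPrime] {A : Matrix m l R}
    {B : Matrix n m R} (h : B * A = 0) (hex : ∀ x, B *ᵥ x = 0 → ∃ s ∉ p, ∃ y, s • x = A *ᵥ y)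
    (hB : B.rankAt p = B.rankAt ⊥) : A.rankAt p + B.rankAt p = Fintype.card m := by
  rw [rankAt_add_rankAt_eq_card_iff p h]
  obtain ⟨H, d, hd, hH⟩ := exists_mul_mul_eq_smul_of_rankAt_eq p B hB
  intro x hx
  -- A cycle modulo `p` is corrected to a true cycle congruent to `d • x` modulo `p`.
  obtain ⟨s, hs, y, hy⟩ := hex (d • x - H *ᵥ (B *ᵥ x)) (by
    rw [mulVec_sub, mulVec_smul, mulVec_mulVec, mulVec_mulVec, hH, smul_mulVec, sub_self])
  refine ⟨s * d, ‹p.IsPrime›.mul_notMem hs hd, y, Ideal.mem_vec.mp ?_⟩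
  rw [← hy, smul_sub, mul_smul, sub_sub_cancel]
  exact Submodule.smul_mem _ _ (Ideal.mulVec_mem_vec H (Ideal.mem_vec.mpr hx))

/-- If `A`, `B` is exact modulo an ideal `I` with associated prime `p` and the rank of `A` does not
drop at `p`, then the homology of the sequence over the residue field vanishes. -/
theorem rankAt_add_rankAt_eq_of_left (p : Ideal R) [p.IsPrime] {A : Matrix m l R}
    {B : Matrix n m R} (h : B * A = 0) {I : Ideal R} {b : R} (hb : ∀ t, t ∈ p ↔ t * b ∈ I)
    (hex : ExactMod I A B) (hA : A.rankAt p = A.rankAt ⊥) :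
    A.rankAt p + B.rankAt p = Fintype.card m := by
  rw [rankAt_add_rankAt_eq_card_iff p h]
  obtain ⟨H, d, hd, hH⟩ := exists_mul_mul_eq_smul_of_rankAt_eq p A hA
  intro x hx
  -- Multiplication by `b` embeds `R/p` into `R/I`, turning a cycle modulo `p` into one modulo `I`.
  obtain ⟨y, hy⟩ := hex (b • x) (by
    rw [mulVec_smul]
    exact Ideal.mem_vec.mpr fun i => by
      simpa [mul_comm] using (hb _).mp (hx i))
  refine ⟨d, hd, H *ᵥ x, fun i => ?_⟩
  rw [hb]
  have e : b • (d • x - A *ᵥ (H *ᵥ x)) =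
      d • (b • x - A *ᵥ y) - A *ᵥ (H *ᵥ (b • x - A *ᵥ y)) := by
    have : A *ᵥ (H *ᵥ (A *ᵥ y)) = d • (A *ᵥ y) := by
      rw [mulVec_mulVec, mulVec_mulVec, hH, smul_mulVec]
    rw [mulVec_sub, mulVec_sub, this, smul_sub, smul_sub, mulVec_smul, mulVec_smul, smul_comm d b]
    abel
  have := sub_mem (Submodule.smul_mem _ d hy)
    (Ideal.mulVec_mem_vec A (Ideal.mulVec_mem_vec H hy))
  rw [← e] at this
  simpa [mul_comm] using Ideal.mem_vec.mp this i

/-- If `A`, `B` is generically exact and the rank of `A` does not drop at `q`, then the homology of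
the sequence vanishes at `q`. -/
theorem exists_smul_eq_mulVec_of_rankAt_eq (q : Ideal R) [q.IsPrime] {A : Matrix m l R}
    {B : Matrix n m R} (h : B * A = 0) (hgen : A.rankAt ⊥ + B.rankAt ⊥ = Fintype.card m)
    (hA : A.rankAt q = A.rankAt ⊥) : ∃ d ∉ q, ∀ x, B *ᵥ x = 0 → ∃ y, d • x = A *ᵥ y := by
  obtain ⟨H, d, hd, hH⟩ := exists_mul_mul_eq_smul_of_rankAt_eq q A hA
  refine ⟨d, hd, fun x hx => ⟨H *ᵥ x, ?_⟩⟩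
  obtain ⟨s, hs, y, hy⟩ := (rankAt_add_rankAt_eq_card_iff ⊥ h).mp hgen x (by simp [hx])
  have hy' : s • x = A *ᵥ y := by
    ext i
    simpa [sub_eq_zero] using hy i
  have hs0 : s ≠ 0 := by simpa using hs
  have : s • (d • x) = s • A *ᵥ (H *ᵥ x) := by
    rw [smul_comm, ← mulVec_smul, ← mulVec_smul, hy', mulVec_mulVec, mulVec_mulVec, hH,
      smul_mulVec]
  exact smul_right_injective _ hs0 this

end Domain

end Matrix

/-! ### Associated primes, regular sequences and depth. -/

section Grade

open RingTheory.Sequence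

variable {R : Type*} [CommRing R]

theorem Ideal.exists_isPrime_forall_mem_iff_mul_mem [IsNoetherianRing R] {I : Ideal R}
    (hI : I ≠ ⊤) : ∃ (p : Ideal R) (b : R), p.IsPrime ∧ ∀ s, s ∈ p ↔ s * b ∈ I := by
  have : Nontrivial (R ⧸ I) := Ideal.Quotient.nontrivial_iff.mpr hI
  obtain ⟨p, hp⟩ := associatedPrimes.nonempty R (R ⧸ I)
  obtain ⟨hp', x, hx⟩ := isAssociatedPrime_iff.mp hp
  obtain ⟨b, rfl⟩ := Ideal.Quotient.mk_surjective x
  refine ⟨p, b, hp', fun s => ?_⟩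
  rw [hx, Submodule.mem_colon_singleton, Submodule.mem_bot, Algebra.smul_def,
    Ideal.Quotient.algebraMap_eq, ← map_mul, Ideal.Quotient.eq_zero_iff_mem]

/-- The zero divisors on `R/I` form a finite union of associated primes, so prime avoidance puts `J`
inside one of them. -/
theorem Ideal.exists_isPrime_le_of_forall_not_regular [IsNoetherianRing R] {I J : Ideal R}
    (h : ∀ r ∈ J, ∃ a, r * a ∈ I ∧ a ∉ I) :
    ∃ (p : Ideal R) (b : R), p.IsPrime ∧ J ≤ p ∧ ∀ s, s ∈ p ↔ s * b ∈ I := by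
  have hsub : (J : Set R) ⊆ ⋃ p ∈ associatedPrimes R (R ⧸ I), (p : Set R) := by
    rw [biUnion_associatedPrimes_eq_zero_divisors]
    intro r hr
    obtain ⟨a, ha, ha'⟩ := h r hr
    refine ⟨Ideal.Quotient.mk I a, fun h0 => ha' (Ideal.Quotient.eq_zero_iff_mem.mp h0), ?_⟩
    rw [Algebra.smul_def, Ideal.Quotient.algebraMap_eq, ← map_mul]
    exact Ideal.Quotient.eq_zero_iff_mem.mpr ha
  obtain ⟨p, hp, hJp⟩ := (Ideal.subset_union_prime_finite
    (associatedPrimes.finite R (R ⧸ I)) (f := id) 0 0 fun _ h _ _ => h.1).mp hsub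
  obtain ⟨hp', x, hx⟩ := isAssociatedPrime_iff.mp hp
  obtain ⟨b, rfl⟩ := Ideal.Quotient.mk_surjective x
  refine ⟨p, b, hp', hJp, fun s => ?_⟩
  rw [hx, Submodule.mem_colon_singleton, Submodule.mem_bot, Algebra.smul_def,
    Ideal.Quotient.algebraMap_eq, ← map_mul, Ideal.Quotient.eq_zero_iff_mem]

theorem isSMulRegular_quotient_smul_top_iff (I : Ideal R) (t : R) :
    IsSMulRegular (R ⧸ (I • ⊤ : Submodule R R)) t ↔ ∀ a, t * a ∈ I → a ∈ I := by
  rw [isSMulRegular_quotient_iff_mem_of_smul_mem]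
  simp

theorem isWeaklyRegular_iff_forall_mem {rs : List R} :
    IsWeaklyRegular R rs ↔ ∀ i (h : i < rs.length),
      ∀ a, rs[i] * a ∈ Ideal.ofList (rs.take i) → a ∈ Ideal.ofList (rs.take i) := by
  rw [isWeaklyRegular_iff]
  simp only [isSMulRegular_quotient_smul_top_iff]

theorem Ideal.ofList_take_succ (rs : List R) {i : ℕ} (h : i < rs.length) :
    Ideal.ofList (rs.take (i + 1)) = Ideal.ofList (rs.take i) ⊔ Ideal.span {rs[i]} := by
  rw [List.take_succ_eq_append_getElem h, Ideal.ofList_append, Ideal.ofList_singleton]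

/-- An ideal has depth at least `n` if no prime ideal containing it is an associated prime of the
quotient by a regular sequence of length less than `n`. -/
theorem Ideal.le_gradeDepth [IsNoetherianRing R] {J : Ideal R} {n : ℕ}
    (h : ∀ rs : List R, rs.length < n → IsWeaklyRegular R rs → ∀ (p : Ideal R) [p.IsPrime] (b : R),
      (∀ s, s ∈ p ↔ s * b ∈ Ideal.ofList rs) → ¬ J ≤ p) : (n : ℕ∞) ≤ J.gradeDepth := by
  have key : ∀ m ≤ n, ∃ rs : List R, (∀ r ∈ rs, r ∈ J) ∧ IsWeaklyRegular R rs ∧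
      rs.length = m := by
    intro m
    induction m with
    | zero => exact fun _ => ⟨[], by simp, .nil R R, rfl⟩
    | succ m ih =>
      intro hm
      obtain ⟨rs, hJ, hreg, rfl⟩ := ih (by omega)
      by_contra hcon
      -- An element of `J` regular modulo `rs` would lengthen the sequence.
      obtain ⟨p, b, hp, hJp, hb⟩ := Ideal.exists_isPrime_le_of_forall_not_regular
        (I := Ideal.ofList rs) (J := J) (by
          intro r hr
          by_contra! hr'
          refine hcon ⟨rs ++ [r], ?_, ?_, by simp⟩
          · intro s hs
            rcases List.mem_append.mp hs with hs | hs
            · exact hJ s hs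
            · rwa [List.mem_singleton.mp hs]
          · rw [isWeaklyRegular_append_iff, isWeaklyRegular_singleton_iff,
              isSMulRegular_quotient_smul_top_iff]
            exact ⟨hreg, hr'⟩)
      exact h rs (by omega) hreg p b hb hJp
  obtain ⟨rs, hJ, hreg, rfl⟩ := key n le_rfl
  exact le_iSup₂_of_le rs ⟨hJ, hreg⟩ le_rfl

theorem Ideal.exists_isWeaklyRegular_of_lt_gradeDepth {J : Ideal R} {n : ℕ}
    (h : (n : ℕ∞) < J.gradeDepth) :
    ∃ rs : List R, (∀ r ∈ rs, r ∈ J) ∧ IsWeaklyRegular R rs ∧ n < rs.length := by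
  obtain ⟨rs, hrs⟩ := lt_iSup_iff.mp h
  obtain ⟨hrs', hlt⟩ := lt_iSup_iff.mp hrs
  exact ⟨rs, hrs'.1, hrs'.2, by exact_mod_cast hlt⟩

end Grade

/-! ### Exactness over the localization at a prime. -/

namespace Matrix

section Localization

variable {R : Type*} [CommRing R] [IsDomain R] {l m n : Type*} [Fintype l] [Fintype m]
  (p : Ideal R) [p.IsPrime] {A : Matrix m l R} {B : Matrix n m R}

theorem exists_smul_eq_map_mulVec {d : R} (h : ∀ x, B *ᵥ x = 0 → ∃ y, d • x = A *ᵥ y)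
    (x : m → Localization.AtPrime p)
    (hx : B.map (algebraMap R (Localization.AtPrime p)) *ᵥ x = 0) :
    ∃ y, algebraMap R (Localization.AtPrime p) d • x =
      A.map (algebraMap R (Localization.AtPrime p)) *ᵥ y := by
  set φ := algebraMap R (Localization.AtPrime p)
  have hφ : Function.Injective φ := IsLocalization.injective _ p.primeCompl_le_nonZeroDivisors
  obtain ⟨s, hs⟩ := IsLocalization.exist_integer_multiples_of_finite p.primeCompl x
  choose z hz using hs
  have e : φ ∘ z = φ s • x := funext fun i => by
    rw [Function.comp_apply, hz, Algebra.smul_def]; rfl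
  obtain ⟨y, hy⟩ := h z (by
    ext i
    apply hφ
    rw [RingHom.map_mulVec, e, mulVec_smul, hx]
    simp)
  obtain ⟨c, hc⟩ := (IsLocalization.map_units (Localization.AtPrime p) s).exists_left_inv
  refine ⟨c • (φ ∘ y), ?_⟩
  have e2 : A.map φ *ᵥ (φ ∘ y) = φ d • φ ∘ z := by
    ext i
    rw [← RingHom.map_mulVec, ← hy]
    simp
  rw [mulVec_smul, e2, e, smul_comm c, smul_smul c, hc, one_smul]

theorem ExactMod.map_localization (h : ExactMod ⊥ A B) :
    ExactMod ⊥ (A.map (algebraMap R (Localization.AtPrime p)))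
      (B.map (algebraMap R (Localization.AtPrime p))) := by
  rw [exactMod_bot_iff] at h ⊢
  intro x hx
  obtain ⟨y, hy⟩ := exists_smul_eq_map_mulVec p (d := 1) (A := A) (B := B) (fun x hx => by
    obtain ⟨y, hy⟩ := h x hx
    exact ⟨y, by rw [hy, one_smul]⟩) x hx
  exact ⟨y, by rw [← hy, map_one, one_smul]⟩

theorem exists_smul_eq_of_exactMod_map_localization
    (h : ExactMod ⊥ (A.map (algebraMap R (Localization.AtPrime p)))
      (B.map (algebraMap R (Localization.AtPrime p)))) (x : m → R) (hx : B *ᵥ x = 0) :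
    ∃ s ∉ p, ∃ y, s • x = A *ᵥ y := by
  set φ := algebraMap R (Localization.AtPrime p)
  have hφ : Function.Injective φ := IsLocalization.injective _ p.primeCompl_le_nonZeroDivisors
  obtain ⟨y', hy'⟩ := exactMod_bot_iff.mp h (φ ∘ x) (by
    ext i
    rw [← RingHom.map_mulVec, hx]
    simp)
  obtain ⟨s, hs⟩ := IsLocalization.exist_integer_multiples_of_finite p.primeCompl y'
  choose y hy using hs
  have e : φ ∘ y = φ s • y' := funext fun i => by
    rw [Function.comp_apply, hy, Algebra.smul_def]; rfl
  refine ⟨s, s.2, y, ?_⟩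
  ext i
  apply hφ
  rw [RingHom.map_mulVec, e, mulVec_smul, hy']
  simp

/-- An exactness criterion over the localization at `p`: it suffices that the homology has no
nonzero element annihilated by the maximal ideal, provided that it vanishes at all smaller
primes. -/
theorem SocleExactMod.exactMod_bot [IsNoetherianRing R]
    (hS : SocleExactMod (IsLocalRing.maximalIdeal (Localization.AtPrime p)) ⊥
      (A.map (algebraMap R (Localization.AtPrime p)))
      (B.map (algebraMap R (Localization.AtPrime p))))
    (hq : ∀ q : Ideal R, q.IsPrime → q < p → ∃ d ∉ q, ∀ x, B *ᵥ x = 0 → ∃ y, d • x = A *ᵥ y) :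
    ExactMod ⊥ (A.map (algebraMap R (Localization.AtPrime p)))
      (B.map (algebraMap R (Localization.AtPrime p))) := by
  set φ := algebraMap R (Localization.AtPrime p) with hφ
  have : IsNoetherianRing (Localization.AtPrime p) :=
    IsLocalization.isNoetherianRing p.primeCompl _ ‹_›
  rw [exactMod_bot_iff]
  intro x hx
  by_contra hcon
  let N := LinearMap.range (A.map φ).mulVecLin
  -- `P` is the annihilator of the class of `t • x` in the homology.
  obtain ⟨P, t, hP, ht⟩ := Ideal.exists_isPrime_forall_mem_iff_mul_mem (I := N.colon {x}) (by
    rw [Ne, Ideal.eq_top_iff_one, Submodule.mem_colon_singleton, one_smul]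
    exact hcon)
  have ht' : ∀ s, s ∈ P ↔ ∃ y, A.map φ *ᵥ y = (s * t) • x := by
    intro s
    rw [ht, Submodule.mem_colon_singleton]
    rfl
  have htx : B.map φ *ᵥ (t • x) = 0 := by rw [mulVec_smul, hx, smul_zero]
  by_cases hPm : P = IsLocalRing.maximalIdeal (Localization.AtPrime p)
  · obtain ⟨y, hy⟩ := hS (t • x) (Ideal.mem_bot_vec.mpr htx) (by
      intro s hs
      rw [← hPm, ht'] at hs
      obtain ⟨y, hy⟩ := hs
      exact ⟨y, Ideal.mem_bot_vec.mpr (by rw [hy, mul_smul, sub_self])⟩)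
    refine hP.one_notMem ((ht' 1).mpr ⟨y, ?_⟩)
    rw [one_mul, ← sub_eq_zero.mp (Ideal.mem_bot_vec.mp hy)]
  -- Otherwise `P` contracts to a prime `q < p`. The element `d ∉ q` kills the homology, yet
  -- annihilating `t • x` puts it in `P`.
  · have hcomap : (IsLocalRing.maximalIdeal (Localization.AtPrime p)).comap φ = p := by
      ext r
      exact IsLocalization.AtPrime.to_map_mem_maximal_iff _ p r
    have hlt : P.comap φ < p := by
      refine lt_of_le_of_ne ?_ ?_
      · exact (Ideal.comap_mono (IsLocalRing.le_maximalIdeal hP.ne_top)).trans hcomap.le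
      · intro he
        apply hPm
        rw [← IsLocalization.map_under p.primeCompl (Localization.AtPrime p) P,
          ← IsLocalization.map_under p.primeCompl (Localization.AtPrime p)
            (IsLocalRing.maximalIdeal _)]
        exact congrArg _ (he.trans hcomap.symm)
    obtain ⟨d, hd, hd'⟩ := hq _ (Ideal.IsPrime.comap φ) hlt
    obtain ⟨y, hy⟩ := exists_smul_eq_map_mulVec p hd' _ htx
    exact hd ((ht' _).mpr ⟨y, by rw [← hy, mul_smul]⟩)

end Localization

end Matrix

/-! ### Acyclicity at primes, its propagation, and the depth estimates. -/

namespace Matrix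

section Complex

open RingTheory.Sequence

variable {R : Type*} [CommRing R] {ι : ℤ → Type*} [∀ i, Fintype (ι i)]

/-- The complex of free modules with differentials `D` has no homology in degree `i` over the
residue field of `p`. -/
def AcyclicAt (D : ∀ i j, Matrix (ι j) (ι i) R) (p : Ideal R) [p.IsPrime] (i : ℤ) : Prop :=
  (D (i - 1) i).rankAt p + (D i (i + 1)).rankAt p = Fintype.card (ι i)

variable {D : ∀ i j, Matrix (ι j) (ι i) R} {p q : Ideal R} [p.IsPrime] [q.IsPrime]

theorem AcyclicAt.of_isEmpty {i : ℤ} [IsEmpty (ι i)] : AcyclicAt D p i := by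
  have h1 := rankAt_le_card_height p (D (i - 1) i)
  have h2 := rankAt_le_card_width p (D i (i + 1))
  rw [Fintype.card_eq_zero (α := ι i)] at h1 h2
  rw [AcyclicAt, Fintype.card_eq_zero (α := ι i)]
  omega

theorem AcyclicAt.rankAt_eq (hD : ∀ i j k, D j k * D i j = 0) (hqp : q ≤ p) {i : ℤ}
    (h : AcyclicAt D p i) : (D (i - 1) i).rankAt p = (D (i - 1) i).rankAt q ∧
      (D i (i + 1)).rankAt p = (D i (i + 1)).rankAt q := by
  have h1 := rankAt_le_rankAt hqp (D (i - 1) i)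
  have h2 := rankAt_le_rankAt hqp (D i (i + 1))
  have h3 := rankAt_add_rankAt_le q (hD (i - 1) i (i + 1))
  rw [AcyclicAt] at h
  omega

theorem AcyclicAt.mono (hD : ∀ i j k, D j k * D i j = 0) (hqp : q ≤ p) {i : ℤ}
    (h : AcyclicAt D p i) : AcyclicAt D q i := by
  have h1 := h.rankAt_eq hD hqp
  rw [AcyclicAt, ← h1.1, ← h1.2]
  exact h

/-- Each element of the regular sequence costs one degree at the upper end of the exact range. -/
theorem ExactMod.ofList_take (hD : ∀ i j k, D j k * D i j = 0) {N : ℤ}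
    (hN : ∀ i < N, ExactMod ⊥ (D (i - 1) i) (D i (i + 1))) {rs : List R}
    (hrs : IsWeaklyRegular R rs) (g : ℕ) (hg : g ≤ rs.length) (i : ℤ) (hi : i < N - g) :
    ExactMod (Ideal.ofList (rs.take g)) (D (i - 1) i) (D i (i + 1)) := by
  induction g generalizing i with
  | zero =>
    rw [List.take_zero, Ideal.ofList_nil]
    exact hN i (by simpa using hi)
  | succ g ih =>
    push_cast at hi
    rw [Ideal.ofList_take_succ rs hg]
    have h := ih (by omega) (i + 1) (by omega)
    rw [add_sub_cancel_right] at h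
    exact (ih (by omega) i (by omega)).sup_span (hD _ _ _) h
      (isWeaklyRegular_iff_forall_mem.mp hrs g hg)

/-- Each step down in degree is paid for by one more element of the sequence; the descent ends in
degree `a`, where exactness holds modulo every ideal. -/
theorem SocleExactMod.ofList_take (hD : ∀ i j k, D j k * D i j = 0) {N a : ℤ}
    (hN : ∀ i < N, ExactMod ⊥ (D (i - 1) i) (D i (i + 1)))
    (ha : ∀ I, ExactMod I (D (a - 1) a) (D a (a + 1))) {𝔪 : Ideal R} {rs : List R}
    (hrs : IsWeaklyRegular R rs) (hrs𝔪 : ∀ r ∈ rs, r ∈ 𝔪) (n g : ℕ) (hg : g + n ≤ rs.length)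
    (hgN : a + n + g ≤ N) :
    SocleExactMod 𝔪 (Ideal.ofList (rs.take g)) (D (a + n - 1) (a + n))
      (D (a + n) (a + n + 1)) := by
  induction n generalizing g with
  | zero =>
    rw [Nat.cast_zero, add_zero]
    exact (ha _).socleExactMod
  | succ n ih =>
    push_cast at hgN
    have h := ih (g + 1) (by omega) (by push_cast; omega)
    rw [Ideal.ofList_take_succ rs (by omega)] at h
    have h2 := ExactMod.ofList_take hD hN hrs g (by omega) (a + n) (by omega)
    have e : a + ((n + 1 : ℕ) : ℤ) = a + n + 1 := by push_cast; ring
    rw [e, add_sub_cancel_right]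
    exact h.succ (hD _ _ _) (hrs𝔪 _ (List.getElem_mem _))
      (isWeaklyRegular_iff_forall_mem.mp hrs g _) h2

theorem acyclicAt_transpose_iff {i : ℤ} :
    AcyclicAt (ι := fun i => ι (-i)) (fun i j => (D (-j) (-i))ᵀ) p i ↔ AcyclicAt D p (-i) := by
  rw [AcyclicAt, AcyclicAt, rankAt_transpose, rankAt_transpose, neg_sub, neg_add, add_comm,
    ← sub_eq_add_neg, sub_eq_neg_add 1 i]

variable [IsDomain R]

/-- If a complex of free modules is split exact at all primes strictly contained in `p`, exact in
degrees less than `a`, and its differentials around the interval `[a, b]` have constant rank at `p`,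
then it is acyclic at `p` in degree `b` as soon as `b - a` is less than the depth at `p`. -/
theorem acyclicAt_of_lt_gradeDepth [IsNoetherianRing R] (hD : ∀ i j k, D j k * D i j = 0) {a b : ℤ}
    (hex : ∀ i < a, ExactMod ⊥ (D (i - 1) i) (D i (i + 1)))
    (ha : (D (a - 1) a).rankAt p = (D (a - 1) a).rankAt ⊥)
    (hb : (D b (b + 1)).rankAt p = (D b (b + 1)).rankAt ⊥)
    (hq : ∀ (q : Ideal R) [q.IsPrime], q < p → ∀ i, AcyclicAt D q i)
    (hd : ((b - a).toNat : ℕ∞) <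
      (IsLocalRing.maximalIdeal (Localization.AtPrime p)).gradeDepth) :
    AcyclicAt D p b := by
  obtain ⟨rs, hrs𝔪, hrs, hlen⟩ := Ideal.exists_isWeaklyRegular_of_lt_gradeDepth hd
  set φ := algebraMap R (Localization.AtPrime p)
  let E : ∀ i j, Matrix (ι j) (ι i) (Localization.AtPrime p) := fun i j => (D i j).map φ
  have hE : ∀ i j k, E j k * E i j = 0 := fun i j k => map_mul_map_eq_zero φ (hD i j k)
  -- Constant rank splits the differential leaving degree `a - 1`; this degree is the foot of the
  -- socle descent.
  have hEa : ∀ I, ExactMod I (E (a - 1 - 1) (a - 1)) (E (a - 1) (a - 1 + 1)) := by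
    obtain ⟨H, d, hdp, hH⟩ := exists_mul_mul_eq_smul_of_rankAt_eq p _ ha
    rw [sub_add_cancel]
    have h1 := (hex (a - 1) (by omega)).map_localization p
    rw [sub_add_cancel] at h1
    refine fun I => h1.of_bot (H := H.map φ)
      (IsLocalization.map_units (Localization.AtPrime p) (⟨d, hdp⟩ : p.primeCompl)) ?_ I
    rw [← Matrix.map_mul, ← Matrix.map_mul, hH]
    ext i j
    simp
  have key : ∀ n : ℕ, ∀ i < a + n, i ≤ b → ExactMod ⊥ (E (i - 1) i) (E i (i + 1)) := by
    intro n
    induction n with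
    | zero => exact fun i hi _ => (hex i (by simpa using hi)).map_localization p
    | succ n ih =>
      intro i hi hib
      by_cases hin : i < a + n
      · exact ih i hin hib
      obtain rfl : i = a - 1 + (n + 1 : ℕ) := by push_cast at hi ⊢; omega
      push_cast at hib
      -- Degree `a + n` lies `n + 1` steps above `a - 1`. Since `n ≤ b - a < rs.length`, the
      -- sequence is long enough.
      have hS := SocleExactMod.ofList_take hE (N := a - 1 + (n + 1 : ℕ))
        (fun i hi => ih i (by push_cast at hi; omega) (by push_cast at hi; omega)) hEa hrs hrs𝔪
        (n + 1) 0 (by omega) (by simp)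
      rw [List.take_zero, Ideal.ofList_nil] at hS
      refine hS.exactMod_bot p fun q hqp hlt => ?_
      have hac := hq q hlt (a - 1 + (n + 1 : ℕ))
      exact exists_smul_eq_mulVec_of_rankAt_eq q (hD _ _ _) (hac.mono hD bot_le)
        (hac.rankAt_eq hD bot_le).1
  exact rankAt_add_rankAt_eq_of_right p (hD _ _ _)
    (exists_smul_eq_of_exactMod_map_localization p
      (key ((b - a).toNat + 1) b (by push_cast; omega) le_rfl)) hb

/-- A complex of free modules, bounded below and exact in negative degrees. -/
structure IsNegExact (D : ∀ i j, Matrix (ι j) (ι i) R) : Prop where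
  comp_eq_zero : ∀ i j k, D j k * D i j = 0
  exists_isEmpty : ∃ k : ℕ, ∀ i < -(k : ℤ), IsEmpty (ι i)
  exact : ∀ i < 0, ExactMod ⊥ (D (i - 1) i) (D i (i + 1))

namespace IsNegExact

theorem acyclicAt_iff (h : IsNegExact D) {i : ℤ} (hi : i < 0) :
    AcyclicAt D p i ↔ (D i (i + 1)).rankAt p = (D i (i + 1)).rankAt ⊥ :=
  ⟨fun h' => (h'.rankAt_eq h.comp_eq_zero bot_le).2, fun h' =>
    rankAt_add_rankAt_eq_of_right p (h.comp_eq_zero _ _ _)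
      (exists_smul_eq_of_exactMod_bot p (h.exact i hi)) h'⟩

theorem acyclicAt_sub_nat (h : IsNegExact D) {i : ℤ} (hi : i ≤ 0) (hp : AcyclicAt D p i) (n : ℕ) :
    AcyclicAt D p (i - n) := by
  induction n with
  | zero => simpa using hp
  | succ n ih =>
    have e : i - (n + 1 : ℕ) = i - n - 1 := by push_cast; ring
    rw [e, h.acyclicAt_iff (by omega), sub_add_cancel]
    -- Acyclicity in one degree fixes the rank of the incoming differential, which is the outgoing
    -- one a degree lower.
    exact (ih.rankAt_eq h.comp_eq_zero bot_le).1

theorem acyclicAt_of_le (h : IsNegExact D) {i j : ℤ} (hij : i ≤ j) (hj : j ≤ 0)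
    (hp : AcyclicAt D p j) :
    AcyclicAt D p i := by
  have := h.acyclicAt_sub_nat hj hp (j - i).toNat
  rwa [Int.toNat_of_nonneg (by omega), sub_sub_cancel] at this

/-- Induction upward from the degrees where the complex is zero: acyclicity in degree `i - 1` keeps
the rank of the differential entering degree `i`, and exactness modulo `rs` does the rest. -/
theorem acyclicAt_of_forall_mem_iff (h : IsNegExact D) {rs : List R} (hrs : IsWeaklyRegular R rs)
    {b : R} (hb : ∀ s, s ∈ p ↔ s * b ∈ Ideal.ofList rs) {i : ℤ} (hi : i < -(rs.length : ℤ)) :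
    AcyclicAt D p i := by
  obtain ⟨k, hk⟩ := h.exists_isEmpty
  have key : ∀ n : ℕ, ∀ i < -(k : ℤ) + n, i < -(rs.length : ℤ) → AcyclicAt D p i := by
    intro n
    induction n with
    | zero =>
      intro i hi _
      have := hk i (by simpa using hi)
      exact .of_isEmpty
    | succ n ih =>
      intro i hi hi'
      push_cast at hi
      have h1 := ((ih (i - 1) (by omega) (by omega)).rankAt_eq h.comp_eq_zero
        (q := ⊥) bot_le).2
      rw [sub_add_cancel] at h1
      have h2 := ExactMod.ofList_take h.comp_eq_zero h.exact hrs rs.length le_rfl i (by omega)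
      rw [List.take_length] at h2
      exact rankAt_add_rankAt_eq_of_left p (h.comp_eq_zero _ _ _) hb h2 h1
  exact key (i + k + 1).toNat i (by omega) hi

theorem le_gradeDepth (h : IsNegExact D) [IsNoetherianRing R] (n : ℕ) {J : Ideal R}
    (hJ : ∀ (p : Ideal R) [p.IsPrime], J ≤ p → ¬ AcyclicAt D p (-(n : ℤ))) :
    (n : ℕ∞) ≤ J.gradeDepth :=
  Ideal.le_gradeDepth fun _ hlt hrs p _ _ hb hJp =>
    hJ p hJp (h.acyclicAt_of_forall_mem_iff hrs hb (by omega))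

end IsNegExact

theorem exists_forall_not_acyclicAt_iff [IsNoetherianRing R] (h : IsNegExact D)
    (h' : IsNegExact (ι := fun i => ι (-i)) (fun i j => (D (-j) (-i))ᵀ))
    (hp : ¬ AcyclicAt D p 0)
    (hq : ∀ (q : Ideal R) [q.IsPrime], q < p → AcyclicAt D q 0) :
    ∃ a b : ℤ, a ≤ 0 ∧ 0 ≤ b ∧
      (IsLocalRing.maximalIdeal (Localization.AtPrime p)).gradeDepth ≤ ((b - a).toNat : ℕ∞) ∧
      ∀ i, ¬ AcyclicAt D p i ↔ a ≤ i ∧ i ≤ b := by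
  have hneg := fun (q : Ideal R) [q.IsPrime] {i j : ℤ} => h.acyclicAt_of_le (p := q) (i := i)
    (j := j)
  have hpos : ∀ (q : Ideal R) [q.IsPrime] {i j : ℤ}, i ≤ j → 0 ≤ i → AcyclicAt D q i →
      AcyclicAt D q j := by
    intro q _ i j hij hi hac
    have := h'.acyclicAt_of_le (p := q) (i := -j) (j := -i) (by omega) (by omega)
      (acyclicAt_transpose_iff.mpr (by rwa [neg_neg]))
    rwa [acyclicAt_transpose_iff, neg_neg] at this
  obtain ⟨k, hk⟩ := h.exists_isEmpty
  obtain ⟨l, hl⟩ := h'.exists_isEmpty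
  obtain ⟨a, ha, ha'⟩ := Int.exists_least_of_bdd (P := fun i => ¬ AcyclicAt D p i)
    ⟨-k, fun z hz => by
      by_contra hlt
      have := hk z (by omega)
      exact hz .of_isEmpty⟩ ⟨0, hp⟩
  obtain ⟨b, hb, hb'⟩ := Int.exists_greatest_of_bdd (P := fun i => ¬ AcyclicAt D p i)
    ⟨l, fun z hz => by
      by_contra hlt
      have := hl (-z) (by omega)
      rw [neg_neg] at this
      exact hz .of_isEmpty⟩ ⟨0, hp⟩
  have ha0 := ha' 0 hp
  have hb0 := hb' 0 hp
  refine ⟨a, b, ha0, hb0, ?_, fun i => ⟨fun hi => ⟨ha' i hi, hb' i hi⟩, fun hi hac => ?_⟩⟩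
  -- Acyclicity just outside `[a, b]` gives `∂^{a-1}` and `∂^b` their generic ranks at `p`.
  · by_contra! hlt
    have h1 : AcyclicAt D p (a - 1) := by
      by_contra hcon
      have := ha' _ hcon
      omega
    have h2 : AcyclicAt D p (b + 1) := by
      by_contra hcon
      have := hb' _ hcon
      omega
    have e1 := (h1.rankAt_eq h.comp_eq_zero (q := ⊥) bot_le).2
    have e2 := (h2.rankAt_eq h.comp_eq_zero (q := ⊥) bot_le).1
    rw [sub_add_cancel] at e1
    rw [add_sub_cancel_right] at e2
    refine hb (acyclicAt_of_lt_gradeDepth h.comp_eq_zero (fun i hi => h.exact i (by omega)) e1 e2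
      (fun q _ hqp i => ?_) hlt)
    -- Below `p`, acyclicity in degree `0` propagates to all degrees.
    rcases le_total i 0 with hi | hi
    · exact hneg q hi le_rfl (hq q hqp)
    · exact hpos q hi le_rfl (hq q hqp)
  · rcases le_total i 0 with hi0 | hi0
    · exact ha (hneg p hi.1 hi0 hac)
    · exact hb (hpos p hi.2 hi0 hac)

end Complex

end Matrix

/-! ### Passage from linear maps to matrices. -/

section Bases

open Matrix Module

variable {R : Type*} [CommRing R] {M₀ M₁ M₂ : Type*} [AddCommGroup M₀] [AddCommGroup M₁]
  [AddCommGroup M₂] [Module R M₀] [Module R M₁] [Module R M₂] {m₀ m₁ m₂ : Type*} [Fintype m₀]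
  [Fintype m₁] [Finite m₂]

theorem exactMod_bot_toMatrix [DecidableEq m₀] [DecidableEq m₁] (b₀ : Basis m₀ R M₀)
    (b₁ : Basis m₁ R M₁) (b₂ : Basis m₂ R M₂)
    {f : M₀ →ₗ[R] M₁} {g : M₁ →ₗ[R] M₂} (h : ∀ x, g x = 0 → ∃ y, f y = x) :
    ExactMod ⊥ (LinearMap.toMatrix b₀ b₁ f) (LinearMap.toMatrix b₁ b₂ g) := by
  cases nonempty_fintype m₂
  rw [exactMod_bot_iff]
  intro x hx
  obtain ⟨y, hy⟩ := h (b₁.equivFun.symm x) (by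
    apply b₂.repr.injective
    ext i
    have := congrFun (LinearMap.toMatrix_mulVec_repr b₁ b₂ g (b₁.equivFun.symm x)) i
    rw [map_zero, ← this]
    have e : ⇑(b₁.repr (b₁.equivFun.symm x)) = x := b₁.equivFun.apply_symm_apply x
    rw [e, hx]
    rfl)
  refine ⟨b₀.repr y, ?_⟩
  rw [LinearMap.toMatrix_mulVec_repr, hy]
  exact b₁.equivFun.apply_symm_apply x

theorem isEmpty_chooseBasisIndex (R M : Type*) [CommRing R] [Nontrivial R] [AddCommGroup M]
    [Module R M] [Module.Free R M] [Subsingleton M] : IsEmpty (Free.ChooseBasisIndex R M) :=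
  ⟨fun i => (Free.chooseBasis R M).ne_zero i (Subsingleton.elim _ _)⟩

/-- Localizing the image at the nonzero elements gives the image over the fraction field, and
`finrank` does not change. -/
theorem finrank_range_mulVecLin_eq_rankAt_bot [IsDomain R] (A : Matrix m₁ m₀ R) :
    finrank R (LinearMap.range A.mulVecLin) = A.rankAt ⊥ := by
  let K := (⊥ : Ideal R).ResidueField
  let Φ : (m₁ → R) →ₗ[R] (m₁ → K) := .pi fun i => Algebra.linearMap R K ∘ₗ .proj i
  have : IsLocalizedModule (nonZeroDivisors R) Φ := inferInstance
  have hΦ : ∀ x i, Φ x i = algebraMap R K (x i) := fun x i => rfl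
  have e : (LinearMap.range A.mulVecLin).localized' K (nonZeroDivisors R) Φ =
      LinearMap.range (A.map (algebraMap R K)).mulVecLin := by
    ext x
    rw [Submodule.mem_localized']
    constructor
    · rintro ⟨_, ⟨y, rfl⟩, s, hs⟩
      rw [IsLocalizedModule.mk'_eq_iff] at hs
      have hs0 : algebraMap R K s ≠ 0 :=
        (IsLocalization.map_units K s).ne_zero
      refine ⟨(algebraMap R K s)⁻¹ • (algebraMap R K ∘ y), ?_⟩
      rw [mulVecLin_apply, mulVec_smul, inv_smul_eq_iff₀ hs0]
      ext i
      rw [← RingHom.map_mulVec]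
      have := congrFun hs i
      rw [hΦ] at this
      rw [← mulVecLin_apply, this]
      simp [Submonoid.smul_def, Algebra.smul_def]
    · rintro ⟨y', rfl⟩
      obtain ⟨s, hs⟩ := IsLocalization.exist_integer_multiples_of_finite (nonZeroDivisors R) y'
      choose y hy using hs
      have e : algebraMap R K ∘ y = algebraMap R K s • y' := funext fun i => by
        rw [Function.comp_apply, hy, Algebra.smul_def]; rfl
      refine ⟨A *ᵥ y, ⟨y, rfl⟩, s, ?_⟩
      rw [IsLocalizedModule.mk'_eq_iff]
      ext i
      rw [hΦ, RingHom.map_mulVec, e, mulVec_smul]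
      simp [Submonoid.smul_def, Algebra.smul_def]
  rw [rankAt, Matrix.rank, ← e, IsFractionRing.finrank_right_eq R K,
    IsLocalizedModule.finrank_eq (nonZeroDivisors R)
      ((LinearMap.range A.mulVecLin).toLocalized' K (nonZeroDivisors R) Φ) le_rfl]

theorem finrank_range_eq_rankAt_bot [IsDomain R] [DecidableEq m₀] (b₀ : Basis m₀ R M₀)
    (b₁ : Basis m₁ R M₁) (f : M₀ →ₗ[R] M₁) :
    finrank R (LinearMap.range f) = (LinearMap.toMatrix b₀ b₁ f).rankAt ⊥ := by
  rw [← finrank_range_mulVecLin_eq_rankAt_bot, ← Matrix.rank,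
    rank_eq_finrank_range_toLin _ b₁ b₀, toLin_toMatrix]

theorem toMatrix_prod_prodMap {N₁ N₂ : Type*} [AddCommGroup N₁] [AddCommGroup N₂] [Module R N₁]
    [Module R N₂] {n₁ n₂ : Type*} [DecidableEq m₀] [DecidableEq m₁] [Finite n₁] [Finite n₂]
    (b₀ : Basis m₀ R M₀) (b₁ : Basis m₁ R M₁) (c₁ : Basis n₁ R N₁) (c₂ : Basis n₂ R N₂) (f : M₀ →ₗ[R] N₁)
    (g : M₁ →ₗ[R] N₂) :
    LinearMap.toMatrix (b₀.prod b₁) (c₁.prod c₂) (f.prodMap g) =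
      fromBlocks (LinearMap.toMatrix b₀ c₁ f) 0 0 (LinearMap.toMatrix b₁ c₂ g) := by
  ext (i | i) (j | j) <;> simp [LinearMap.toMatrix_apply]

end Bases

theorem HomologicalComplex.exists_of_isZero_homology {R : Type u} [Ring R]
    (F : CochainComplex (ModuleCat.{u} R) ℤ) (i : ℤ) (h : Limits.IsZero (F.homology i))
    (x : F.X i) (hx : (F.d i (i + 1)).hom x = 0) : ∃ y, (F.d (i - 1) i).hom y = x := by
  rw [← HomologicalComplex.exactAt_iff_isZero_homology,
    HomologicalComplex.exactAt_iff' _ (i - 1) i (i + 1) (by simp) (by simp),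
    ShortComplex.moduleCat_exact_iff] at h
  exact h x hx

/-! ### Fitting and jumping ideals in terms of ranks at primes. -/

namespace CochainComplex

open Matrix Module

variable {R : Type u} [CommRing R] (F : CochainComplex (ModuleCat.{u} R) ℤ)
  [∀ i, Module.Free R (F.X i)] [∀ i, Module.Finite R (F.X i)]

open Classical in
/-- The matrices of the differentials of a complex of finitely generated free modules. -/
noncomputable def differentialMatrix (i j : ℤ) :
    Matrix (Free.ChooseBasisIndex R (F.X j)) (Free.ChooseBasisIndex R (F.X i)) R :=
  LinearMap.toMatrix (Free.chooseBasis R (F.X i)) (Free.chooseBasis R (F.X j)) (F.d i j).hom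

theorem differentialMatrix_mul (i j k : ℤ) :
    F.differentialMatrix j k * F.differentialMatrix i j = 0 := by
  classical
  rw [differentialMatrix, differentialMatrix, ← LinearMap.toMatrix_comp, ← ModuleCat.hom_comp,
    F.d_comp_d]
  simp

/-- The matrix is block diagonal, so its rank at `p` is the sum of the two ranks. This sum never
exceeds the rank of `F^i`, so all minors of that size lie in `p` exactly when equality fails. -/
theorem jumpingIdeal_le_iff [Nontrivial R] (p : Ideal R) [p.IsPrime] (i : ℤ) :
    F.jumpingIdeal i ≤ p ↔ ¬ AcyclicAt F.differentialMatrix p i := by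
  classical
  have h := rankAt_add_rankAt_le p (F.differentialMatrix_mul (i - 1) i (i + 1))
  rw [jumpingIdeal, determinantalIdeal_eq
    ((Free.chooseBasis R (F.X (i - 1))).prod (Free.chooseBasis R (F.X i)))
    ((Free.chooseBasis R (F.X i)).prod (Free.chooseBasis R (F.X (i + 1)))), minorsIdeal_le_iff,
    toMatrix_prod_prodMap, rankAt_fromBlocks_diagonal, finrank_eq_card_chooseBasisIndex, AcyclicAt]
  exact ⟨fun h' => h'.ne, fun h' => lt_of_le_of_ne h h'⟩

theorem fittingIdeal_le_iff [IsDomain R] (p : Ideal R) [p.IsPrime] (i : ℤ) :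
    F.fittingIdeal i ≤ p ↔ (F.differentialMatrix i (i + 1)).rankAt p ≠
      (F.differentialMatrix i (i + 1)).rankAt ⊥ := by
  classical
  have h := rankAt_le_rankAt (bot_le : ⊥ ≤ p) (F.differentialMatrix i (i + 1))
  rw [fittingIdeal, determinantalIdeal, minorsIdeal_le_iff,
    finrank_range_eq_rankAt_bot (Free.chooseBasis R (F.X i)) (Free.chooseBasis R (F.X (i + 1)))]
  exact ⟨fun h' => h'.ne, fun h' => lt_of_le_of_ne h h'⟩

theorem isNegExact [IsDomain R] {k l : ℕ}
    (hF : ∀ i : ℤ, i < -(k : ℤ) ∨ (l : ℤ) < i → Limits.IsZero (F.X i))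
    (hH : ∀ i : ℤ, i < 0 → Limits.IsZero (F.homology i)) :
    IsNegExact F.differentialMatrix where
  comp_eq_zero := F.differentialMatrix_mul
  exists_isEmpty := ⟨k, fun i hi => by
    have := ModuleCat.subsingleton_of_isZero (hF i (Or.inl hi))
    exact isEmpty_chooseBasisIndex R _⟩
  exact i hi := exactMod_bot_toMatrix _ _ _ (HomologicalComplex.exists_of_isZero_homology F i
    (hH i hi))

theorem isNegExact_transpose [IsDomain R] {k l : ℕ}
    (hF : ∀ i : ℤ, i < -(k : ℤ) ∨ (l : ℤ) < i → Limits.IsZero (F.X i))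
    (hH' : ∀ i : ℤ, i < 0 → Limits.IsZero (F.dualComplex.homology i)) :
    IsNegExact (ι := fun i => Free.ChooseBasisIndex R (F.X (-i)))
      (fun i j => (F.differentialMatrix (-j) (-i))ᵀ) where
  comp_eq_zero i j k := by rw [← transpose_mul, differentialMatrix_mul, transpose_zero]
  exists_isEmpty := ⟨l, fun i hi => by
    have := ModuleCat.subsingleton_of_isZero (hF (-i) (Or.inr (by omega)))
    exact isEmpty_chooseBasisIndex R _⟩
  exact i hi := by
    classical
    rw [differentialMatrix, differentialMatrix, ← LinearMap.toMatrix_transpose,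
      ← LinearMap.toMatrix_transpose]
    exact exactMod_bot_toMatrix _ _ _ (HomologicalComplex.exists_of_isZero_homology F.dualComplex i
      (hH' i hi))

end CochainComplex

/-! ### Irreducible components in the prime and maximal spectra. -/

section IrreducibleComponents

/-- Maximality is inherited by smaller sets. As all jump loci lie in the one of degree `0`, only an
inclusion remains to be tested. -/
theorem IsIrreducibleComponentOf.iff_subset {X : Type*} [TopologicalSpace X] {V S T : Set X}
    (h : IsIrreducibleComponentOf V S) (hTS : T ⊆ S) : IsIrreducibleComponentOf V T ↔ V ⊆ T :=
  ⟨fun h' => h'.prop.2, fun h' => ⟨⟨h.prop.1, h'⟩, fun _ hW hVW =>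
    h.le_of_ge ⟨hW.1, hW.2.trans hTS⟩ hVW⟩⟩

variable {R : Type*} [CommRing R]

theorem PrimeSpectrum.exists_eq_zeroLocus_of_isIrreducibleComponentOf {J : Ideal R}
    {V : Set (PrimeSpectrum R)} (hV : IsIrreducibleComponentOf V (zeroLocus (J : Set R))) :
    ∃ p : PrimeSpectrum R, V = zeroLocus (p.asIdeal : Set R) ∧ p.asIdeal ∈ J.minimalPrimes := by
  have hp := isIrreducible_iff_vanishingIdeal_isPrime.mp hV.prop.1
  have hJ : J ≤ vanishingIdeal V := (subset_zeroLocus_iff_le_vanishingIdeal V J).mp hV.prop.2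
  -- Such a `q` defines an irreducible subset of the locus containing `V`, so maximality of `V`
  -- forces equality.
  have hmax : ∀ q : Ideal R, q.IsPrime → J ≤ q → q ≤ vanishingIdeal V →
      V = zeroLocus (q : Set R) := fun q hq hJq hqV =>
    hV.eq_of_le ⟨(isIrreducible_zeroLocus_iff_of_radical q hq.isRadical).mpr hq,
      zeroLocus_anti_mono hJq⟩ ((subset_zeroLocus_iff_le_vanishingIdeal V q).mpr hqV)
  refine ⟨⟨vanishingIdeal V, hp⟩, hmax _ hp hJ le_rfl, ⟨hp, hJ⟩, fun q hq hqV => ?_⟩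
  have := hmax q hq.1 hq.2 hqV
  have h2 := vanishingIdeal_zeroLocus_eq_radical q
  rw [← this, hq.1.radical] at h2
  exact h2.le

theorem PrimeSpectrum.zeroLocus_subset_zeroLocus_iff_le (p : PrimeSpectrum R) (J : Ideal R) :
    zeroLocus (p.asIdeal : Set R) ⊆ zeroLocus (J : Set R) ↔ J ≤ p.asIdeal := by
  rw [subset_zeroLocus_iff_le_vanishingIdeal, vanishingIdeal_zeroLocus_eq_radical,
    p.isPrime.radical]

namespace MaximalSpectrum

theorem isPrime_iInf_of_isIrreducible {V : Set (MaximalSpectrum R)} (hV : IsIrreducible V) :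
    (⨅ x ∈ V, x.asIdeal).IsPrime := by
  have := PrimeSpectrum.isIrreducible_iff_vanishingIdeal_isPrime.mp
    (hV.image toPrimeSpectrum toPrimeSpectrum_continuous.continuousOn)
  rw [PrimeSpectrum.vanishingIdeal, iInf_image] at this
  exact this

theorem iInf_asIdeal_of_isPrime [IsJacobsonRing R] (q : Ideal R) [hq : q.IsPrime] :
    ⨅ x ∈ {x : MaximalSpectrum R | q ≤ x.asIdeal}, x.asIdeal = q := by
  apply le_antisymm
  · have h := Ideal.radical_eq_jacobson q
    rw [hq.radical] at h
    conv_rhs => rw [h]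
    refine le_sInf fun m hm => ?_
    exact iInf₂_le (⟨m, hm.2⟩ : MaximalSpectrum R) hm.1
  · exact le_iInf₂ fun x hx => hx

theorem isIrreducible_of_isPrime [IsJacobsonRing R] (q : Ideal R) [hq : q.IsPrime] :
    IsIrreducible {x : MaximalSpectrum R | q ≤ x.asIdeal} := by
  obtain ⟨m, hm, hqm⟩ := Ideal.exists_le_maximal q hq.ne_top
  refine ⟨⟨⟨m, hm⟩, hqm⟩, isPreirreducible_iff_isClosed_union_isClosed.mpr ?_⟩
  intro Z₁ Z₂ hZ₁ hZ₂ hZ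
  obtain ⟨_, hC₁, rfl⟩ := isClosed_induced_iff.mp hZ₁
  obtain ⟨_, hC₂, rfl⟩ := isClosed_induced_iff.mp hZ₂
  obtain ⟨I₁, rfl⟩ := (PrimeSpectrum.isClosed_iff_zeroLocus_ideal _).mp hC₁
  obtain ⟨I₂, rfl⟩ := (PrimeSpectrum.isClosed_iff_zeroLocus_ideal _).mp hC₂
  -- In a Jacobson ring `q` is the intersection of the maximal ideals above it, and each of these
  -- contains `I₁` or `I₂`.
  have hle : I₁ * I₂ ≤ q := by
    rw [← iInf_asIdeal_of_isPrime q]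
    refine le_iInf₂ fun x hx => ?_
    rcases hZ hx with h | h
    · exact Ideal.mul_le_left.trans h
    · exact Ideal.mul_le_right.trans h
  rcases hq.mul_le.mp hle with h | h
  · exact Or.inl fun x hx => h.trans hx
  · exact Or.inr fun x hx => h.trans hx

theorem exists_eq_of_isIrreducibleComponentOf [IsJacobsonRing R] {J : Ideal R}
    {V : Set (MaximalSpectrum R)}
    (hV : IsIrreducibleComponentOf V {x : MaximalSpectrum R | J ≤ x.asIdeal}) :
    ∃ p : PrimeSpectrum R, V = {x : MaximalSpectrum R | p.asIdeal ≤ x.asIdeal} ∧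
      p.asIdeal ∈ J.minimalPrimes := by
  have hp := isPrime_iInf_of_isIrreducible hV.prop.1
  have hJ : J ≤ ⨅ x ∈ V, x.asIdeal := le_iInf₂ fun x hx => hV.prop.2 hx
  have hmax : ∀ q : Ideal R, q.IsPrime → J ≤ q → q ≤ ⨅ x ∈ V, x.asIdeal →
      V = {x : MaximalSpectrum R | q ≤ x.asIdeal} := fun q hq hJq hqV =>
    hV.eq_of_le ⟨isIrreducible_of_isPrime q, fun x hx => hJq.trans hx⟩
      fun x hx => hqV.trans (iInf₂_le x hx)
  refine ⟨⟨⨅ x ∈ V, x.asIdeal, hp⟩, hmax _ hp hJ le_rfl, ⟨hp, hJ⟩, fun q hq hqV => ?_⟩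
  have := hq.1
  have h1 := iInf_asIdeal_of_isPrime q
  rw [← hmax q hq.1 hq.2 hqV] at h1
  exact h1.le

theorem setOf_le_subset_setOf_le_iff [IsJacobsonRing R] (p : PrimeSpectrum R) (J : Ideal R) :
    {x : MaximalSpectrum R | p.asIdeal ≤ x.asIdeal} ⊆ {x | J ≤ x.asIdeal} ↔ J ≤ p.asIdeal := by
  refine ⟨fun h => ?_, fun h x hx => h.trans hx⟩
  rw [← iInf_asIdeal_of_isPrime p.asIdeal]
  exact le_iInf₂ fun x hx => h hx

end MaximalSpectrum

end IrreducibleComponents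

/-! ### Assembly of the theorem. -/

theorem Ideal.radical_eq_radical_of_forall_isPrime {R : Type*} [CommRing R] {I J : Ideal R}
    (h : ∀ (p : Ideal R) [p.IsPrime], I ≤ p ↔ J ≤ p) : I.radical = J.radical := by
  rw [Ideal.radical_eq_sInf, Ideal.radical_eq_sInf]
  congr 1
  ext p
  constructor
  · rintro ⟨h1, h2⟩
    exact ⟨(h p).mp h1, h2⟩
  · rintro ⟨h1, h2⟩
    exact ⟨(h p).mpr h1, h2⟩

theorem mainTheorem6 {R : Type u} [CommRing R] [IsDomain R] [IsNoetherianRing R]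
    (F : CochainComplex (ModuleCat.{u} R) ℤ)
    [∀ i, Module.Free R (F.X i)] [∀ i, Module.Finite R (F.X i)]
    (k l : ℕ) (hF : ∀ i : ℤ, i < -(k : ℤ) ∨ (l : ℤ) < i → Limits.IsZero (F.X i))
    (hH : ∀ i : ℤ, i < 0 → Limits.IsZero (F.homology i))
    (hH' : ∀ i : ℤ, i < 0 → Limits.IsZero (F.dualComplex.homology i)) :
    -- comparison of the radicals of the Fitting and jumping ideals
    (∀ i : ℤ, i < 0 → (F.fittingIdeal i).radical = (F.jumpingIdeal i).radical) ∧
    (∀ i : ℤ, 0 < i → (F.fittingIdeal (i - 1)).radical = (F.jumpingIdeal i).radical) ∧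
    -- propagation, in the prime spectrum and in the maximal spectrum
    (∀ i j : ℤ, i ≤ j → j ≤ 0 → F.jumpLocus i ⊆ F.jumpLocus j) ∧
    (∀ i j : ℤ, 0 ≤ i → i ≤ j → F.jumpLocus j ⊆ F.jumpLocus i) ∧
    (∀ i j : ℤ, i ≤ j → j ≤ 0 → F.maxJumpLocus i ⊆ F.maxJumpLocus j) ∧
    (∀ i j : ℤ, 0 ≤ i → i ≤ j → F.maxJumpLocus j ⊆ F.maxJumpLocus i) ∧
    -- depth lower bound
    (∀ i : ℕ, (i : ℕ∞) ≤ (F.jumpingIdeal i).gradeDepth ∧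
      (i : ℕ∞) ≤ (F.jumpingIdeal (-(i : ℤ))).gradeDepth) ∧
    -- irreducible components of the jump locus in degree `0`, in the prime spectrum
    (∀ V : Set (PrimeSpectrum R), IsIrreducibleComponentOf V (F.jumpLocus 0) →
      ∃ p : PrimeSpectrum R, V = PrimeSpectrum.zeroLocus (p.asIdeal : Set R) ∧
        ∃ a₁ a₂ : ℤ, a₁ ≤ 0 ∧ 0 ≤ a₂ ∧
          (IsLocalRing.maximalIdeal (Localization.AtPrime p.asIdeal)).gradeDepth ≤
            ((a₂ - a₁).toNat : ℕ∞) ∧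
          ∀ i : ℤ, IsIrreducibleComponentOf V (F.jumpLocus i) ↔ a₁ ≤ i ∧ i ≤ a₂) ∧
    -- the same in the maximal spectrum, for a Jacobson ring
    (IsJacobsonRing R →
      ∀ V : Set (MaximalSpectrum R), IsIrreducibleComponentOf V (F.maxJumpLocus 0) →
        ∃ p : PrimeSpectrum R, V = {x : MaximalSpectrum R | p.asIdeal ≤ x.asIdeal} ∧
          ∃ a₁ a₂ : ℤ, a₁ ≤ 0 ∧ 0 ≤ a₂ ∧
            (IsLocalRing.maximalIdeal (Localization.AtPrime p.asIdeal)).gradeDepth ≤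
              ((a₂ - a₁).toNat : ℕ∞) ∧
            ∀ i : ℤ, IsIrreducibleComponentOf V (F.maxJumpLocus i) ↔ a₁ ≤ i ∧ i ≤ a₂) := by
  have h := F.isNegExact hF hH
  have h' := F.isNegExact_transpose hF hH'
  have hneg : ∀ (q : Ideal R) [q.IsPrime] {i j : ℤ}, i ≤ j → j ≤ 0 → F.jumpingIdeal i ≤ q →
      F.jumpingIdeal j ≤ q := by
    intro q _ i j hij hj hi
    rw [F.jumpingIdeal_le_iff] at hi ⊢
    exact fun hac => hi (h.acyclicAt_of_le hij hj hac)
  have hpos : ∀ (q : Ideal R) [q.IsPrime] {i j : ℤ}, 0 ≤ i → i ≤ j → F.jumpingIdeal j ≤ q →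
      F.jumpingIdeal i ≤ q := by
    intro q _ i j hi hij hj
    rw [F.jumpingIdeal_le_iff, ← neg_neg j, ← Matrix.acyclicAt_transpose_iff] at hj
    rw [F.jumpingIdeal_le_iff, ← neg_neg i, ← Matrix.acyclicAt_transpose_iff]
    exact fun hac => hj (h'.acyclicAt_of_le (by omega) (by omega) hac)
  have hzero : ∀ (q : Ideal R) [q.IsPrime] (i : ℤ), F.jumpingIdeal i ≤ q →
      F.jumpingIdeal 0 ≤ q := by
    intro q _ i hi
    rcases le_total i 0 with h0 | h0
    · exact hneg q h0 le_rfl hi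
    · exact hpos q le_rfl h0 hi
  have hcomp : ∀ p : PrimeSpectrum R, p.asIdeal ∈ (F.jumpingIdeal 0).minimalPrimes →
      ∃ a₁ a₂ : ℤ, a₁ ≤ 0 ∧ 0 ≤ a₂ ∧
        (IsLocalRing.maximalIdeal (Localization.AtPrime p.asIdeal)).gradeDepth ≤
          ((a₂ - a₁).toNat : ℕ∞) ∧
        ∀ i, F.jumpingIdeal i ≤ p.asIdeal ↔ a₁ ≤ i ∧ i ≤ a₂ := by
    intro p hp
    simp only [F.jumpingIdeal_le_iff]
    refine Matrix.exists_forall_not_acyclicAt_iff h h'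
      ((F.jumpingIdeal_le_iff _ _).mp hp.1.2) fun q _ hqp => ?_
    -- Minimality of `p` over `J^0` gives acyclicity in degree `0` at every smaller prime.
    by_contra hcon
    exact hqp.not_ge (hp.2 ⟨‹_›, (F.jumpingIdeal_le_iff _ _).mpr hcon⟩ hqp.le)
  refine ⟨fun i hi => ?_, fun i hi => ?_, fun i j hij hj x hx => ?_, fun i j hi hij x hx => ?_,
    fun i j hij hj x hx => ?_, fun i j hi hij x hx => ?_, fun i => ⟨?_, ?_⟩, fun V hV => ?_,
    fun hR V hV => ?_⟩
  · refine Ideal.radical_eq_radical_of_forall_isPrime fun p _ => ?_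
    rw [F.jumpingIdeal_le_iff, F.fittingIdeal_le_iff, h.acyclicAt_iff hi]
  · refine Ideal.radical_eq_radical_of_forall_isPrime fun p _ => ?_
    -- The dual differential leaving degree `-i` is the transpose of `∂^{i-1}`, whence the shift of
    -- index.
    rw [F.jumpingIdeal_le_iff, F.fittingIdeal_le_iff, ← neg_neg i,
      ← Matrix.acyclicAt_transpose_iff, h'.acyclicAt_iff (by omega), Matrix.rankAt_transpose,
      Matrix.rankAt_transpose, neg_neg, neg_add, neg_neg, ← sub_eq_add_neg, sub_add_cancel]
  · exact hneg x.asIdeal hij hj hx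
  · exact hpos x.asIdeal hi hij hx
  · exact hneg x.asIdeal hij hj hx
  · exact hpos x.asIdeal hi hij hx
  · refine h'.le_gradeDepth i fun p _ hp hac => (F.jumpingIdeal_le_iff p i).mp hp ?_
    have := (Matrix.acyclicAt_transpose_iff (D := F.differentialMatrix)).mp hac
    rwa [neg_neg] at this
  · exact h.le_gradeDepth i fun p _ hp => (F.jumpingIdeal_le_iff p _).mp hp
  · obtain ⟨p, hVp, hp⟩ := PrimeSpectrum.exists_eq_zeroLocus_of_isIrreducibleComponentOf hV
    obtain ⟨a, b, ha, hb, hab, hi⟩ := hcomp p hp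
    refine ⟨p, hVp, a, b, ha, hb, hab, fun i => ?_⟩
    rw [hV.iff_subset (T := F.jumpLocus i) fun x hx => hzero x.asIdeal i hx, ← hi, hVp]
    exact PrimeSpectrum.zeroLocus_subset_zeroLocus_iff_le p _
  · obtain ⟨p, hVp, hp⟩ := MaximalSpectrum.exists_eq_of_isIrreducibleComponentOf hV
    obtain ⟨a, b, ha, hb, hab, hi⟩ := hcomp p hp
    refine ⟨p, hVp, a, b, ha, hb, hab, fun i => ?_⟩
    rw [hV.iff_subset (T := F.maxJumpLocus i) fun x hx => hzero x.asIdeal i hx, ← hi, hVp]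
    exact MaximalSpectrum.setOf_le_subset_setOf_le_iff p _
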